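/- Let $I$ be an at most countable set, let $\ell^2(I)$ be the complex Hilbert space with standard orthonormal basis $\{e_i\}_{i\in I}$, and for $A\subset I$ let $P_A$ be the orthogonal projection of $\ell^2(I)$ onto $\overline{\operatorname{span}}\{e_i : i\in A\}$. The diagonal entries of a bounded operator $T$ on $\ell^2(I)$ are $\langle Te_i,e_i\rangle$, $i\in I$. For a positive integer $r$ and $\varepsilon>0$, we say that $T$ can be $(r,\varepsilon)$-paved if there is a partition of $I$ into $r$ pairwise disjoint (possibly empty) sets $A_1,\dots,A_r$ such that $\|P_{A_j}TP_{A_j}\|\le\varepsilon\|T\|$ for all $j=1,\dots,r$. Theorem (Anderson paving). (PB) For every $\varepsilon>0$ there exists $r=r(\varepsilon)\in\mathbb N$, independent of $I$ and $T$, such that every bounded operator $T$ on $\ell^2(I)$ with zero diagonal can be $(r,\varepsilon)$-paved. (PS) For every $\varepsilon>0$ there exists $r=r(\varepsilon)\in\mathbb N$, independent of $I$ and $S$, such that every bounded self-adjoint operator $S$ on $\ell^2(I)$ with zero diagonal can be $(r,\varepsilon)$-paved. (PR) For every $\varepsilon>0$ there exists $r=r(\varepsilon)\in\mathbb N$, independent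 of $I$ and $R$, such that every reflection $R$ on $\ell^2(I)$, i.e. $R=R^*$ and $R^2=\mathbf I$, with zero diagonal can be $(r,\varepsilon)$-paved. (PP$_{1/2}$) For every $\varepsilon>0$, every projection $P$ on $\ell^2(I)$, i.e. $P=P^*$ and $P^2=P$, with all diagonal entries equal to $\frac12$ can be $(r,\frac{1+\varepsilon}{2})$-paved for every integer $r\ge 36/\varepsilon^2$ (in particular for $r=36/\varepsilon^2$ when this is an integer, and for $r=\lceil 36/\varepsilon^2\rceil$ in general). -/

import Mathlib

universe u

namespace Paving

/-- The complex Hilbert space `ℓ²(I)`. -/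
abbrev ell2 (I : Type u) : Type u := lp (fun _ : I => ℂ) 2

open Classical in
/-- The standard orthonormal basis vector `e_i` of `ℓ²(I)`. -/
noncomputable def basisVec {I : Type u} (i : I) : ell2 I := lp.single 2 i (1 : ℂ)

/-- The closed linear span of `{e_i : i ∈ A}` in `ℓ²(I)`. -/
noncomputable def coordSubspace {I : Type u} (A : Set I) : Submodule ℂ (ell2 I) :=
  (Submodule.span ℂ (basisVec '' A)).topologicalClosure

instance coordSubspace_completeSpace {I : Type u} (A : Set I) :
    CompleteSpace (coordSubspace A) :=
  (Submodule.isClosed_topologicalClosure _).completeSpace_coe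

/-- The orthogonal projection `P_A` of `ℓ²(I)` onto the closed span of `{e_i : i ∈ A}`,
as a bounded operator on `ℓ²(I)`. -/
noncomputable def coordProj {I : Type u} (A : Set I) : ell2 I →L[ℂ] ell2 I :=
  (coordSubspace A).starProjection

/-- The `i`-th diagonal entry `⟨T e_i, e_i⟩` of `T`
(Mathlib's inner product is linear in its second argument). -/
noncomputable def diagEntry {I : Type u} (T : ell2 I →L[ℂ] ell2 I) (i : I) : ℂ :=
  inner ℂ (basisVec i) (T (basisVec i))

/-- `T` has `(r, ε)`-paving: there is a partition of `I` into `r` sets `A_j`, some of them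
possibly empty, with `‖P_{A_j} T P_{A_j}‖ ≤ ε ‖T‖` for all `j`. -/
def HasPaving {I : Type u} (T : ell2 I →L[ℂ] ell2 I) (r : ℕ) (ε : ℝ) : Prop :=
  ∃ A : Fin r → Set I,
    (∀ j k, j ≠ k → Disjoint (A j) (A k)) ∧ (⋃ j, A j) = Set.univ ∧
    ∀ j, ‖coordProj (A j) * T * coordProj (A j)‖ ≤ ε * ‖T‖

end Paving

open Polynomial Filter Topology
open scoped ComplexConjugate

set_option linter.unusedSectionVars false

namespace Paving

/-! ### Principal minors of `diag z - A` with independent variables on the diagonal. -/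

section Minors

variable {ι : Type*} [Fintype ι] [DecidableEq ι]

/-! Everything reduces to finite Hermitian matrices `0 ≤ A ≤ 1` with diagonal `1/2`, for which an
`r`-coloring is sought whose diagonal blocks are all at most `(1+ε)/2`. To a tuple of sets `B_k`
attach the product of the principal minors of `x - A` on the `B_k`; a coloring is good as soon as
its product has no zero above `(1+ε)/2` (`herm_re_le_of_principalMinor_ne_zero`). The method is that
of interlacing polynomials. The sum of these products over all colorings is studied first, and a
single coloring is then extracted from it.

For the sum, give each index `j` its own variable `z_j`. A minor is affine in `z_j`, so distributing
`j` over the `r` sets amounts to applying `∂_j^(r-1)/(r-1)!` to the product in which `j` lies in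
every set. This operation preserves nonvanishing on the product of upper half planes
(`Stable.sumAt_one`). A multivariate barrier argument controls real zeros: if the logarithmic
derivatives are at most `φ` above a point, one such operation allows the `j`-th coordinate to be
lowered by `(r-1)²/(rφ)` with the same `φ` (`topPolar_barrier`, `Barrier.sumAt_one`). The initial
`φ` at `1+s` comes from `HalfContraction.barrier`, where the diagonal `1/2` bounds the diagonal of
the resolvent; `barrier_bound` optimizes `s` and yields `36/ε²`.

For the extraction, indices are placed one at a time. All nonnegative combinations of the `r`
candidates are stable, so one candidate inherits a zero-free ray from their sum
(`exists_forall_eval_ne_zero`, `exists_distribution`).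

Finite colorings are glued by Rado selection. Projections are a direct instance; a self-adjoint `S`
is handled through `(1 ± S/‖S‖)/2` and a common refinement, a general `T` through its real and
imaginary parts, and reflections are special self-adjoint operators. -/

/-- The matrix `diag z - A` on the rows and columns in `S`, and the identity elsewhere. -/
noncomputable def principalMat (A : Matrix ι ι ℂ) (S : Finset ι) (z : ι → ℂ) : Matrix ι ι ℂ :=
  Matrix.of fun i j =>
    if i ∈ S ∧ j ∈ S then (Matrix.diagonal z - A) i j else (1 : Matrix ι ι ℂ) i j

/-- The principal minor of `diag z - A` on `S`. -/
noncomputable def principalMinor (A : Matrix ι ι ℂ) (S : Finset ι) (z : ι → ℂ) : ℂ :=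
  (principalMat A S z).det

/-- When row `j` is a unit vector, the determinant equals its `(j,j)` cofactor, which does not see
column `j`. That column may therefore be altered freely off the diagonal. -/
lemma det_eq_of_row_single {N N' : Matrix ι ι ℂ} (j : ι) (hN : N j = Pi.single j 1)
    (hN' : N' j = Pi.single j 1) (h : ∀ i k, k ≠ j → N i k = N' i k) : N.det = N'.det := by
  have key : ∀ M : Matrix ι ι ℂ, M j = Pi.single j 1 →
      M.det = (M.updateCol j (Pi.single j 1)).det := by
    intro M hM
    have h1 : M.adjugate j j = M.det := by
      rw [Matrix.adjugate_apply, ← hM, Matrix.updateRow_eq_self]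
    have h2 : M.transpose.adjugate j j = M.adjugate j j := by
      rw [← Matrix.adjugate_transpose]; rfl
    rw [← h1, ← h2, Matrix.adjugate_apply, Matrix.updateRow_transpose, Matrix.det_transpose]
  rw [key N hN, key N' hN']
  congr 1
  ext i k
  by_cases hk : k = j
  · subst hk; simp
  · simp [Matrix.updateCol_ne hk, h i k hk]

variable (A : Matrix ι ι ℂ)

lemma principalMinor_empty (z : ι → ℂ) : principalMinor A ∅ z = 1 := by
  have : principalMat A ∅ z = 1 := by ext i j; simp [principalMat]
  rw [principalMinor, this, Matrix.det_one]

lemma principalMinor_congr {S : Finset ι} {z w : ι → ℂ} (h : ∀ i ∈ S, z i = w i) :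
    principalMinor A S z = principalMinor A S w := by
  unfold principalMinor
  congr 1
  ext i j
  simp only [principalMat, Matrix.of_apply]
  split_ifs with hij
  · by_cases e : i = j
    · subst e; simp [h i hij.1]
    · simp [Matrix.diagonal_apply_ne _ e]
  · rfl

lemma principalMinor_update_of_notMem {S : Finset ι} {j : ι} (hj : j ∉ S) (z : ι → ℂ) (t : ℂ) :
    principalMinor A S (Function.update z j t) = principalMinor A S z :=
  principalMinor_congr A fun i hi => by
    rw [Function.update_of_ne]; rintro rfl; exact hj hi

/-- The variable `z_j` occurs only in the diagonal entry of row `j`, so the minor is affine in it.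
Its slope is the minor with `j` removed; this drives the whole argument. -/
lemma principalMinor_insert {S : Finset ι} {j : ι} (hj : j ∉ S) (z : ι → ℂ) (t : ℂ) :
    principalMinor A (insert j S) (Function.update z j t) =
      t * principalMinor A S z + principalMinor A (insert j S) (Function.update z j 0) := by
  set M := principalMat A (insert j S) (Function.update z j 0) with hM
  have h1 : principalMat A (insert j S) (Function.update z j t) =
      M.updateRow j (t • Pi.single j 1 + M j) := by
    ext i k
    by_cases hi : i = j
    · subst hi
      simp only [Matrix.updateRow_self, hM, principalMat, Matrix.of_apply, Pi.add_apply,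
        Pi.smul_apply, smul_eq_mul]
      by_cases hk : k = i
      · subst hk; simp; ring
      · have hk' : i ≠ k := fun e => hk e.symm
        simp [Matrix.diagonal_apply_ne _ hk', hk]
    · rw [Matrix.updateRow_ne hi]
      simp only [hM, principalMat, Matrix.of_apply]
      by_cases hk : i = k
      · subst hk; simp [Function.update_of_ne hi]
      · simp [Matrix.diagonal_apply_ne _ hk]
  have h2 : (M.updateRow j (Pi.single j 1)).det = principalMinor A S z := by
    apply det_eq_of_row_single j
    · simp
    · ext k
      simp [principalMat, hj, Matrix.one_apply, Pi.single_apply, eq_comm]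
    · intro i k hk
      by_cases hi : i = j
      · subst hi
        simp [principalMat, hj, Matrix.one_apply, Pi.single_apply, eq_comm]
      · rw [Matrix.updateRow_ne hi]
        simp only [hM, principalMat, Matrix.of_apply, Finset.mem_insert, hi, hk, false_or]
        by_cases e : i = k
        · subst e; simp [Function.update_of_ne hi]
        · simp [Matrix.diagonal_apply_ne _ e]
  rw [principalMinor, h1, Matrix.det_updateRow_add, Matrix.det_updateRow_smul, h2,
    Matrix.updateRow_eq_self]
  rfl

lemma principalMinor_conj (hA : A.IsHermitian) (S : Finset ι) (z : ι → ℂ) :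
    conj (principalMinor A S z) = principalMinor A S (fun i => conj (z i)) := by
  have h : (principalMat A S z).conjTranspose = principalMat A S (fun i => conj (z i)) := by
    ext i j
    have hij : conj (A j i) = A i j := hA.apply i j
    simp only [Matrix.conjTranspose_apply, principalMat, Matrix.of_apply]
    by_cases e : i = j
    · subst e
      by_cases hi : i ∈ S <;> simp [hi, hij]
    · have e' : j ≠ i := fun h => e h.symm
      by_cases hi : i ∈ S <;> by_cases hj : j ∈ S <;>
        simp [hi, hj, hij, Matrix.diagonal_apply_ne _ e, Matrix.diagonal_apply_ne _ e',
          Matrix.one_apply_ne e, Matrix.one_apply_ne e']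
  rw [principalMinor, principalMinor, ← h, Matrix.det_conjTranspose]
  rfl

lemma continuous_principalMinor (S : Finset ι) : Continuous (principalMinor A S) := by
  unfold principalMinor
  apply Continuous.matrix_det
  refine continuous_matrix fun i j => ?_
  simp only [principalMat, Matrix.of_apply]
  split_ifs
  · by_cases e : i = j
    · subst e; simp; fun_prop
    · simp [Matrix.diagonal_apply_ne _ e]; fun_prop
  · fun_prop

lemma exists_polynomial_principalMinor (S : Finset ι) :
    ∃ f : ℂ[X], ∀ x : ℂ, f.eval x = principalMinor A S (fun _ => x) := by
  refine ⟨(Matrix.of fun i j => if i ∈ S ∧ j ∈ S then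
    (Matrix.diagonal (fun _ => X) - A.map C : Matrix ι ι ℂ[X]) i j else (1 : Matrix ι ι ℂ[X]) i j).det,
    fun x => ?_⟩
  rw [principalMinor, ← Polynomial.coe_evalRingHom, RingHom.map_det]
  congr 1
  ext i j
  simp only [RingHom.mapMatrix_apply, Matrix.map_apply, Matrix.of_apply, principalMat]
  by_cases e : i = j
  · subst e; split_ifs <;> simp
  · split_ifs <;> simp [Matrix.diagonal_apply_ne _ e, Matrix.one_apply_ne e]

/-- The Hermitian form of `A`. -/
noncomputable def herm (v : ι → ℂ) : ℂ := star v ⬝ᵥ A.mulVec v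

/-- Take a kernel vector: the identity rows outside `S` make it vanish there, and the remaining rows
are an eigenvalue equation. Pairing that equation with `v` turns a zero of a minor into a scalar
identity for the Hermitian form. -/
lemma exists_of_principalMinor_eq_zero {S : Finset ι} {z : ι → ℂ}
    (h : principalMinor A S z = 0) :
    ∃ v : ι → ℂ, v ≠ 0 ∧ (∀ i ∉ S, v i = 0) ∧ (∀ i ∈ S, z i * v i = A.mulVec v i) ∧
      ∑ i, z i * (‖v i‖ ^ 2 : ℝ) = herm A v := by
  obtain ⟨v, hv0, hv⟩ := Matrix.exists_mulVec_eq_zero_iff.mpr h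
  have h0 : ∀ i ∉ S, v i = 0 := by
    intro i hi
    have := congrFun hv i
    simpa [principalMat, Matrix.mulVec, dotProduct, hi, Matrix.one_apply] using this
  have h1 : ∀ i ∈ S, z i * v i = A.mulVec v i := by
    intro i hi
    have h2 := congrFun hv i
    have h3 : (principalMat A S z).mulVec v i = ((Matrix.diagonal z - A).mulVec v) i := by
      simp only [Matrix.mulVec, dotProduct, principalMat, Matrix.of_apply]
      refine Finset.sum_congr rfl fun k _ => ?_
      by_cases hk : k ∈ S
      · simp [hi, hk]
      · simp [h0 k hk]
    rw [h3, Matrix.sub_mulVec, Pi.sub_apply, Matrix.mulVec_diagonal, Pi.zero_apply] at h2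
    exact sub_eq_zero.mp h2
  refine ⟨v, hv0, h0, h1, ?_⟩
  simp only [herm, dotProduct]
  refine Finset.sum_congr rfl fun i _ => ?_
  by_cases hi : i ∈ S
  · rw [← h1 i hi, Complex.ofReal_pow, ← Complex.mul_conj']
    simp only [Pi.star_apply, RCLike.star_def]; ring
  · simp [h0 i hi]

lemma herm_im (hA : A.IsHermitian) (v : ι → ℂ) : (herm A v).im = 0 := by
  have : star (herm A v) = herm A v := by
    unfold herm
    rw [← Matrix.star_dotProduct, Matrix.star_mulVec, hA.eq, ← Matrix.dotProduct_mulVec]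
  exact Complex.conj_eq_iff_im.mp this

/-- At a zero, the imaginary part of the form identity reads `∑ Im(z_i) |v_i|² = 0`, which forces `v
= 0`. -/
lemma principalMinor_ne_zero (hA : A.IsHermitian) (S : Finset ι) {z : ι → ℂ}
    (hz : ∀ i, 0 < (z i).im) : principalMinor A S z ≠ 0 := by
  intro h
  obtain ⟨v, hv0, -, -, hs⟩ := exists_of_principalMinor_eq_zero A h
  have := congrArg Complex.im hs
  rw [herm_im A hA, Complex.im_sum] at this
  simp only [Complex.im_mul_ofReal] at this
  rw [Finset.sum_eq_zero_iff_of_nonneg (fun i _ => mul_nonneg (hz i).le (by positivity))] at this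
  apply hv0
  ext i
  have := this i (Finset.mem_univ i)
  have := (mul_eq_zero.mp this).resolve_left (hz i).ne'
  simpa using this

/-- Definiteness rules out zeros, and it survives raising any `y_j`. A negative minor, being affine
in `y_j` with positive slope by induction, would reach zero at a larger `y_j`. -/
lemma principalMinor_re_pos (hA : A.IsHermitian) (S : Finset ι) (y : ι → ℝ)
    (hy : ∀ v : ι → ℂ, v ≠ 0 → (herm A v).re < ∑ i, y i * ‖v i‖ ^ 2) :
    0 < (principalMinor A S (fun i => y i)).re := by
  have hre : ∀ (S : Finset ι) (y : ι → ℝ), (principalMinor A S (fun i => y i)).im = 0 := by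
    intro S y
    apply Complex.conj_eq_iff_im.mp
    rw [principalMinor_conj A hA]; simp
  have hne : ∀ (S : Finset ι) (y : ι → ℝ),
      (∀ v : ι → ℂ, v ≠ 0 → (herm A v).re < ∑ i, y i * ‖v i‖ ^ 2) →
      (principalMinor A S (fun i => y i)).re ≠ 0 := by
    intro S y hy h
    obtain ⟨v, hv0, -, -, hs⟩ := exists_of_principalMinor_eq_zero A
      (Complex.ext h (hre S y) : principalMinor A S (fun i => y i) = 0)
    have := congrArg Complex.re hs
    rw [Complex.re_sum] at this
    simp only [Complex.re_mul_ofReal, Complex.ofReal_re] at this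
    exact (hy v hv0).ne this.symm
  induction S using Finset.induction_on with
  | empty => simp [principalMinor_empty]
  | insert j S hj ih =>
    by_contra hneg
    have hlt := lt_of_le_of_ne (not_lt.mp hneg) (hne _ y hy)
    set β := (principalMinor A S (fun i => (y i : ℂ))).re with hβ
    set γ := (principalMinor A (insert j S) (fun i => (y i : ℂ))).re with hγ
    have hup : ∀ t : ℝ, (principalMinor A (insert j S)
        (fun i => (Function.update y j t i : ℝ))).re = γ + (t - y j) * β := by
      intro t
      have e : ∀ t : ℝ, (fun i => ((Function.update y j t i : ℝ) : ℂ)) =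
          Function.update (fun i => (y i : ℂ)) j (t : ℂ) := by
        intro t; ext i; by_cases hi : i = j
        · subst hi; simp
        · simp [hi]
      have h1 := principalMinor_insert A hj (fun i => (y i : ℂ)) t
      have h2 := principalMinor_insert A hj (fun i => (y i : ℂ)) (y j)
      rw [Function.update_eq_self] at h2
      rw [e, h1, hγ, h2]
      simp only [Complex.add_re, Complex.re_ofReal_mul, ← hβ]
      ring
    -- The point `y j - γ/β` is the zero of the affine function of `t`.
    have ht : y j ≤ y j - γ / β := by
      have : γ / β < 0 := div_neg_of_neg_of_pos hlt ih
      linarith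
    refine hne (insert j S) (Function.update y j (y j - γ / β)) ?_ ?_
    · intro v hv
      refine (hy v hv).trans_le (Finset.sum_le_sum fun i _ => ?_)
      by_cases hi : i = j
      · subst hi; simp only [Function.update_self]; gcongr
      · rw [Function.update_of_ne hi]
    · rw [hup]; field_simp; ring

end Minors

/-! ### Top coefficients of products of linear polynomials. -/

section LinearProducts

variable {κ R : Type*} [DecidableEq κ] [CommRing R] (α β : κ → R)

lemma natDegree_prod_linear_le (s : Finset κ) :
    (∏ k ∈ s, (C (β k) * X + C (α k))).natDegree ≤ s.card := by
  refine (natDegree_prod_le _ _).trans ?_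
  refine (Finset.sum_le_card_nsmul s _ 1 fun k _ => natDegree_linear_le).trans ?_
  simp

lemma coeff_card_prod_linear (s : Finset κ) :
    (∏ k ∈ s, (C (β k) * X + C (α k))).coeff s.card = ∏ k ∈ s, β k := by
  have := coeff_prod_of_natDegree_le s (fun k => C (β k) * X + C (α k)) 1
    (fun k _ => natDegree_linear_le)
  simpa using this

lemma coeff_prod_linear (s : Finset κ) (n : ℕ) (hn : s.card = n + 1) :
    (∏ k ∈ s, (C (β k) * X + C (α k))).coeff n = ∑ k ∈ s, α k * ∏ l ∈ s.erase k, β l := by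
  induction s using Finset.induction_on generalizing n with
  | empty => simp at hn
  | insert a s ha ih =>
    rw [Finset.card_insert_of_notMem ha] at hn
    have hn : s.card = n := by omega
    have hsum : ∑ k ∈ s, α k * ∏ l ∈ (insert a s).erase k, β l =
        β a * ∑ k ∈ s, α k * ∏ l ∈ s.erase k, β l := by
      rw [Finset.mul_sum]
      refine Finset.sum_congr rfl fun k hk => ?_
      have hka : k ≠ a := by rintro rfl; exact ha hk
      rw [Finset.erase_insert_of_ne hka.symm, Finset.prod_insert (by simp [ha])]
      ring
    rw [Finset.prod_insert ha, Finset.sum_insert ha, Finset.erase_insert ha, hsum, add_mul,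
      coeff_add, coeff_C_mul, mul_assoc, coeff_C_mul, ← coeff_card_prod_linear α β s, hn, add_comm]
    congr 1
    cases n with
    | zero => simp [Finset.card_eq_zero.mp hn]
    | succ m => rw [coeff_X_mul, ih m hn]

end LinearProducts

/-- For `f = a t ^ r + b t ^ (r - 1) + ⋯`, the value `r a t + b`, i.e. the `(r - 1)`-st
derivative of `f` divided by `(r - 1)!`. -/
def topPolar {R : Type*} [CommRing R] (r : ℕ) (f : R[X]) (t : R) : R :=
  r * f.coeff r * t + f.coeff (r - 1)

lemma topPolar_sum {R κ : Type*} [CommRing R] (r : ℕ) (s : Finset κ) (f : κ → R[X]) (t : R) :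
    topPolar r (∑ k ∈ s, f k) t = ∑ k ∈ s, topPolar r (f k) t := by
  simp only [topPolar, finsetSum_coeff, Finset.sum_add_distrib, Finset.mul_sum, Finset.sum_mul]

lemma topPolar_C_mul {R : Type*} [CommRing R] (r : ℕ) (c : R) (f : R[X]) (t : R) :
    topPolar r (C c * f) t = c * topPolar r f t := by
  simp only [topPolar, coeff_C_mul]; ring

/-! ### Distributing indices over `r` sets, polarization and stability. -/

section Families

variable {ι : Type*} [Fintype ι] [DecidableEq ι] {r : ℕ}

/-- Functions of an `r`-tuple of finite sets and a point of `ℂ ^ ι`. -/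
abbrev Family (ι : Type*) (r : ℕ) := (Fin r → Finset ι) → (ι → ℂ) → ℂ

/-- Insert `j` into the `k`-th set of a tuple. -/
def addAt (j : ι) (k : Fin r) (B : Fin r → Finset ι) : Fin r → Finset ι :=
  Function.update B k (insert j (B k))

/-- Insert `j` into every set of a tuple. -/
def addAll (j : ι) (B : Fin r → Finset ι) : Fin r → Finset ι := fun k => insert j (B k)

/-- Insert `j` into every set of a tuple but the `k`-th. -/
def addExcept (j : ι) (k : Fin r) (B : Fin r → Finset ι) : Fin r → Finset ι :=
  Function.update (addAll j B) k (B k)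

/-- Sum over the places in which `j` can be inserted, with weights `c`. -/
def sumAt (c : Fin r → ℂ) (j : ι) (F : Family ι r) : Family ι r :=
  fun B z => ∑ k, c k * F (addAt j k B) z

lemma addAt_comm (i j : ι) (k l : Fin r) (B : Fin r → Finset ι) :
    addAt i k (addAt j l B) = addAt j l (addAt i k B) := by
  funext m
  by_cases h1 : m = k <;> by_cases h2 : m = l
  · subst h1; subst h2; simp [addAt, Finset.insert_comm]
  · subst h1; simp [addAt, h2]
  · subst h2; simp [addAt, h1]
  · simp [addAt, h1, h2]

lemma addAt_addAll (i j : ι) (k : Fin r) (B : Fin r → Finset ι) :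
    addAt i k (addAll j B) = addAll j (addAt i k B) := by
  funext m
  by_cases h1 : m = k
  · subst h1; simp [addAt, addAll, Finset.insert_comm]
  · simp [addAt, addAll, h1]

lemma addAt_addExcept (i j : ι) (k l : Fin r) (B : Fin r → Finset ι) :
    addAt i k (addExcept j l B) = addExcept j l (addAt i k B) := by
  funext m
  by_cases h1 : m = k <;> by_cases h2 : m = l
  · subst h1; subst h2; simp [addAt, addExcept]
  · subst h1; simp [addAt, addExcept, addAll, h2, Finset.insert_comm]
  · subst h2; simp [addAt, addExcept, h1]
  · simp [addAt, addExcept, addAll, h1, h2]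

lemma notMem_addAt {i j : ι} (hij : i ≠ j) (l : Fin r) {B : Fin r → Finset ι}
    (hB : ∀ k, j ∉ B k) (k : Fin r) : j ∉ addAt i l B k := by
  by_cases h : k = l
  · subst h; simp [addAt, hB, hij.symm]
  · simp [addAt, h, hB]

lemma notMem_addAll {i j : ι} (hij : i ≠ j) {B : Fin r → Finset ι}
    (hB : ∀ k, j ∉ B k) (k : Fin r) : j ∉ addAll i B k := by
  simp [addAll, hB, hij.symm]

lemma sumAt_comm (c c' : Fin r → ℂ) (i j : ι) (F : Family ι r) :
    sumAt c i (sumAt c' j F) = sumAt c' j (sumAt c i F) := by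
  funext B z
  simp only [sumAt, Finset.mul_sum]
  rw [Finset.sum_comm]
  refine Finset.sum_congr rfl fun k _ => Finset.sum_congr rfl fun l _ => ?_
  rw [addAt_comm]; ring

/-- On tuples avoiding `j`, inserting `j` everywhere gives a polynomial of degree at most `r` in
the `j`-th coordinate, whose leading coefficient, polar and derivative are values of `F`. -/
def Polarizes (F : Family ι r) (j : ι) : Prop :=
  ∀ B : Fin r → Finset ι, (∀ k, j ∉ B k) → ∀ z : ι → ℂ, ∃ f : ℂ[X],
    f.natDegree ≤ r ∧ (∀ t, f.eval t = F (addAll j B) (Function.update z j t)) ∧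
    f.coeff r = F B z ∧
    (∀ t, topPolar r f t = sumAt 1 j F B (Function.update z j t)) ∧
    ∀ t, f.derivative.eval t = ∑ k, F (addExcept j k B) (Function.update z j t)

/-- Every clause is linear in the family, and inserting `i` commutes with each way of inserting `j`.
-/
lemma Polarizes.sumAt {F : Family ι r} {i j : ι} (hF : Polarizes F j) (hij : i ≠ j)
    (c : Fin r → ℂ) : Polarizes (sumAt c i F) j := by
  intro B hB z
  choose f hdeg heval hlead hpol hder using
    fun k => hF (addAt i k B) (notMem_addAt hij k hB) z
  refine ⟨∑ k, C (c k) * f k, ?_, fun t => ?_, ?_, fun t => ?_, fun t => ?_⟩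
  · exact natDegree_sum_le_of_forall_le _ _ fun k _ => (natDegree_C_mul_le _ _).trans (hdeg k)
  · simp only [eval_finsetSum, eval_mul, eval_C, heval, Paving.sumAt, addAt_addAll]
  · simp only [finsetSum_coeff, coeff_C_mul, hlead, Paving.sumAt]
  · rw [sumAt_comm]
    simp only [topPolar_sum, topPolar_C_mul, hpol]
    simp only [Paving.sumAt, Finset.mul_sum]
  · simp only [derivative_sum, derivative_C_mul, eval_finsetSum, eval_mul, eval_C, hder,
      Paving.sumAt, Finset.mul_sum, addAt_addExcept]
    rw [Finset.sum_comm]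

/-- The family of products of principal minors. -/
noncomputable def minorFamily (A : Matrix ι ι ℂ) (r : ℕ) : Family ι r :=
  fun B z => ∏ k, principalMinor A (B k) z

/-- Each minor is affine in the `j`-th variable, so the product is `∏ (β_k t + α_k)`. Replacing all
factors but one by their slopes gives the polar, and replacing exactly one gives the derivative. -/
lemma polarizes_minorFamily (A : Matrix ι ι ℂ) (hr : 0 < r) (j : ι) :
    Polarizes (minorFamily A r) j := by
  intro B hB z
  set β : Fin r → ℂ := fun k => principalMinor A (B k) z with hβ
  set α : Fin r → ℂ := fun k => principalMinor A (insert j (B k)) (Function.update z j 0) with hα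
  have hins : ∀ k t, principalMinor A (insert j (B k)) (Function.update z j t) =
      β k * t + α k := fun k t => by rw [principalMinor_insert A (hB k)]; ring
  have hbase : ∀ k t, principalMinor A (B k) (Function.update z j t) = β k :=
    fun k t => principalMinor_update_of_notMem A (hB k) z t
  have hcard : (Finset.univ : Finset (Fin r)).card = r := by simp
  refine ⟨∏ k, (C (β k) * X + C (α k)), ?_, fun t => ?_, ?_, fun t => ?_, fun t => ?_⟩
  · simpa using natDegree_prod_linear_le α β Finset.univ
  · simp [eval_prod, minorFamily, addAll, hins]
  · simpa [minorFamily] using coeff_card_prod_linear α β Finset.univ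
  · have h1 := coeff_card_prod_linear α β Finset.univ
    have h2 := coeff_prod_linear α β Finset.univ (r - 1) (by rw [hcard]; omega)
    rw [hcard] at h1
    rw [topPolar, h1, h2]
    have h3 : ∀ k, minorFamily A r (addAt j k B) (Function.update z j t) =
        (β k * t + α k) * ∏ l ∈ Finset.univ.erase k, β l := by
      intro k
      rw [minorFamily, ← Finset.mul_prod_erase _ _ (Finset.mem_univ k)]
      congr 1
      · simp [addAt, hins]
      · refine Finset.prod_congr rfl fun l hl => ?_
        simp [addAt, Finset.ne_of_mem_erase hl, hbase]
    simp only [sumAt, Pi.one_apply, one_mul, h3, add_mul, Finset.sum_add_distrib]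
    congr 1
    have h4 : ∀ k, β k * t * ∏ l ∈ Finset.univ.erase k, β l = t * ∏ l, β l := by
      intro k
      rw [← Finset.mul_prod_erase _ _ (Finset.mem_univ k)]; ring
    simp only [h4, Finset.sum_const, hcard, nsmul_eq_mul]
    ring
  · rw [derivative_prod_finset, eval_finsetSum]
    refine Finset.sum_congr rfl fun k _ => ?_
    rw [minorFamily, ← Finset.mul_prod_erase _ _ (Finset.mem_univ k), eval_mul, mul_comm]
    congr 1
    · simp [addExcept, hbase]
    · rw [eval_prod]
      refine Finset.prod_congr rfl fun l hl => ?_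
      simp [addExcept, addAll, Finset.ne_of_mem_erase hl, hins]

/-- Nonvanishing on the product of upper half planes, for tuples avoiding `L`. -/
def Stable (F : Family ι r) (L : List ι) : Prop :=
  ∀ B : Fin r → Finset ι, (∀ i ∈ L, ∀ k, i ∉ B k) → ∀ z : ι → ℂ, (∀ i, 0 < (z i).im) → F B z ≠ 0

/-- By Vieta the coefficient below the leading one is minus the leading coefficient times the sum of
the roots. -/
lemma topPolar_eq_sum_roots {K : Type*} [Field K] {r : ℕ} (hr : 0 < r) {f : K[X]}
    (hs : f.Splits) (hd : f.natDegree ≤ r) (hc : f.coeff r ≠ 0) (t : K) :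
    f.roots.card = r ∧ topPolar r f t = f.coeff r * (f.roots.map fun a => t - a).sum := by
  have hdeg : f.natDegree = r := natDegree_eq_of_le_of_coeff_ne_zero hd hc
  have hcard : f.roots.card = r := by rw [← hs.natDegree_eq_card_roots, hdeg]
  refine ⟨hcard, ?_⟩
  have h1 := hs.nextCoeff_eq_neg_sum_roots_mul_leadingCoeff
  rw [nextCoeff_of_natDegree_pos (by omega), leadingCoeff, hdeg] at h1
  rw [topPolar, h1, Multiset.sum_map_sub]
  simp only [Multiset.map_const', Multiset.sum_replicate, hcard, Multiset.map_id', nsmul_eq_mul]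
  ring

/-- A Gauss–Lucas argument: the polynomial in the `i`-th variable has all its roots `a` in the
closed lower half plane. Hence its polar at `z_i` is a nonzero multiple of `∑ (z_i - a)`, whose
imaginary part is positive. -/
lemma Stable.sumAt_one {F : Family ι r} {L : List ι} {i : ι} (hr : 0 < r) (hF : Stable F L)
    (hP : Polarizes F i) (hi : i ∉ L) : Stable (sumAt 1 i F) (i :: L) := by
  intro B hB z hz
  have hBi : ∀ k, i ∉ B k := hB i (by simp)
  have hBL : ∀ l ∈ L, ∀ k, l ∉ B k := fun l hl => hB l (by simp [hl])
  obtain ⟨f, hdeg, heval, hlead, hpol, -⟩ := hP B hBi z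
  have hc : f.coeff r ≠ 0 := by rw [hlead]; exact hF B hBL z hz
  have hroot : ∀ a ∈ f.roots, 0 < (z i - a).im := by
    intro a ha
    have h0 : f.eval a = 0 := (mem_roots'.mp ha).2
    have : ¬ 0 < a.im := by
      intro hpos
      rw [heval] at h0
      refine hF _ ?_ _ ?_ h0
      · intro l hl
        exact notMem_addAll (by rintro rfl; exact hi hl) (hBL l hl)
      · intro l
        by_cases h : l = i
        · subst h; simpa using hpos
        · simpa [h] using hz l
    have := hz i
    rw [Complex.sub_im]; linarith
  obtain ⟨hcard, hsum⟩ := topPolar_eq_sum_roots hr (IsAlgClosed.splits f) hdeg hc (z i)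
  have := hpol (z i)
  rw [Function.update_eq_self] at this
  rw [← this, hsum]
  refine mul_ne_zero hc fun h => ?_
  have him := congrArg Complex.imAddGroupHom h
  rw [map_multiset_sum, Multiset.map_map] at him
  have hne : f.roots ≠ 0 := by rw [← Multiset.card_pos, hcard]; exact hr
  have hpos : 0 < (f.roots.map (Complex.imAddGroupHom ∘ fun a => z i - a)).sum := by
    obtain ⟨a, ha⟩ := Multiset.exists_mem_of_ne_zero hne
    obtain ⟨s, hs⟩ := Multiset.exists_cons_of_mem ha
    rw [hs, Multiset.map_cons, Multiset.sum_cons]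
    refine add_pos_of_pos_of_nonneg (hroot a ha) (Multiset.sum_nonneg ?_)
    intro x hx
    obtain ⟨b, hb, rfl⟩ := Multiset.mem_map.mp hx
    exact (hroot b (by rw [hs]; exact Multiset.mem_cons_of_mem hb)).le
  rw [him] at hpos
  simp at hpos

lemma stable_minorFamily {A : Matrix ι ι ℂ} (hA : A.IsHermitian) :
    Stable (minorFamily A r) [] := fun B _ _ hz =>
  Finset.prod_ne_zero_iff.mpr fun k _ => principalMinor_ne_zero A hA (B k) hz

/-- Arbitrary nonnegative weights are needed for the interlacing step. After division by the product
of minors, the sum is a weighted sum of ratios `w` of the minor with `j` to the minor without. Each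
`w` has positive imaginary part: the minor with `j` vanishes when `z_j` is replaced by `z_j - w`,
and stability forbids this point from lying in the upper half plane. -/
lemma stable_sumAt_minorFamily {A : Matrix ι ι ℂ} (hA : A.IsHermitian) {c : Fin r → ℝ}
    (hc : ∀ k, 0 ≤ c k) (hc' : ∃ k, 0 < c k) (j : ι) :
    Stable (sumAt (fun k => c k) j (minorFamily A r)) [j] := by
  intro B hB z hz
  have hBj : ∀ k, j ∉ B k := hB j (by simp)
  have hβ : ∀ k, principalMinor A (B k) z ≠ 0 := fun k => principalMinor_ne_zero A hA (B k) hz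
  have hratio : ∀ k, 0 < (principalMinor A (insert j (B k)) z / principalMinor A (B k) z).im := by
    intro k
    by_contra hneg
    set w := principalMinor A (insert j (B k)) z / principalMinor A (B k) z with hw
    have h1 := principalMinor_insert A (hBj k) z (z j)
    have h2 := principalMinor_insert A (hBj k) z (z j - w)
    rw [Function.update_eq_self] at h1
    have h3 : principalMinor A (insert j (B k)) (Function.update z j (z j - w)) = 0 := by
      have : w * principalMinor A (B k) z = principalMinor A (insert j (B k)) z :=
        div_mul_cancel₀ _ (hβ k)
      rw [h2, sub_mul, this, h1]; ring
    refine principalMinor_ne_zero A hA _ (fun l => ?_) h3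
    by_cases h : l = j
    · subst h; have := hz l; simp only [Function.update_self, Complex.sub_im]; linarith
    · simpa [h] using hz l
  have hform : sumAt (fun k => (c k : ℂ)) j (minorFamily A r) B z =
      (∏ k, principalMinor A (B k) z) *
        ∑ k, c k * (principalMinor A (insert j (B k)) z / principalMinor A (B k) z) := by
    rw [sumAt, Finset.mul_sum]
    refine Finset.sum_congr rfl fun k _ => ?_
    rw [minorFamily, ← Finset.mul_prod_erase _ _ (Finset.mem_univ k),
      ← Finset.mul_prod_erase _ (fun k => principalMinor A (B k) z) (Finset.mem_univ k)]
    have : ∏ l ∈ Finset.univ.erase k, principalMinor A (addAt j k B l) z =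
        ∏ l ∈ Finset.univ.erase k, principalMinor A (B l) z :=
      Finset.prod_congr rfl fun l hl => by simp [addAt, Finset.ne_of_mem_erase hl]
    rw [this]
    have := hβ k
    simp only [addAt, Function.update_self]
    field_simp
  rw [hform]
  refine mul_ne_zero (Finset.prod_ne_zero_iff.mpr fun k _ => hβ k) fun h => ?_
  have him := congrArg Complex.im h
  simp only [Complex.im_sum, Complex.im_ofReal_mul, Complex.zero_im] at him
  obtain ⟨k, hk⟩ := hc'
  have := Finset.sum_pos' (fun k (_ : k ∈ Finset.univ) => mul_nonneg (hc k) (hratio k).le)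
    ⟨k, Finset.mem_univ k, mul_pos hk (hratio k)⟩
  linarith

/-- Sum over all ways to distribute the elements of `V` over the sets of a tuple. -/
def distribute (V : List ι) (F : Family ι r) : Family ι r := V.foldr (sumAt 1) F

@[simp] lemma distribute_nil (F : Family ι r) : distribute [] F = F := rfl

@[simp] lemma distribute_cons (j : ι) (V : List ι) (F : Family ι r) :
    distribute (j :: V) F = sumAt 1 j (distribute V F) := rfl

lemma sumAt_distribute (c : Fin r → ℂ) (j : ι) (V : List ι) (F : Family ι r) :
    sumAt c j (distribute V F) = distribute V (sumAt c j F) := by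
  induction V with
  | nil => rfl
  | cons i V ih => rw [distribute_cons, sumAt_comm, ih]; rfl

lemma Polarizes.distribute {F : Family ι r} {j : ι} (hF : Polarizes F j) {V : List ι}
    (hj : j ∉ V) : Polarizes (distribute V F) j := by
  induction V with
  | nil => exact hF
  | cons i V ih =>
    rw [List.mem_cons, not_or] at hj
    exact (ih hj.2).sumAt (Ne.symm hj.1) 1

lemma Stable.distribute {F : Family ι r} {L : List ι} (hr : 0 < r) (hF : Stable F L)
    {V : List ι} (hP : ∀ i ∈ V, Polarizes F i) (hV : (V ++ L).Nodup) :
    Stable (distribute V F) (V ++ L) := by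
  induction V with
  | nil => exact hF
  | cons i V ih =>
    rw [List.cons_append, List.nodup_cons] at hV
    have hi : i ∉ V := fun h => hV.1 (by simp [h])
    exact (ih (fun j hj => hP j (by simp [hj])) hV.2).sumAt_one hr
      ((hP i (by simp)).distribute hi) hV.1

/-- Real structure and regularity shared by all families in use. -/
structure Regular (F : Family ι r) : Prop where
  conj_apply : ∀ B z, conj (F B z) = F B fun i => conj (z i)
  continuous : ∀ B, Continuous (F B)
  diagonal : ∀ B, ∃ f : ℂ[X], ∀ x : ℂ, f.eval x = F B fun _ => x

lemma Regular.sumAt_one {F : Family ι r} (hF : Regular F) (j : ι) : Regular (sumAt 1 j F) where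
  conj_apply B z := by simp [sumAt, map_sum, hF.conj_apply]
  continuous B := by
    unfold sumAt
    exact continuous_finsetSum _ fun k _ => continuous_const.mul (hF.continuous _)
  diagonal B := by
    choose f hf using fun k => hF.diagonal (addAt j k B)
    exact ⟨∑ k, f k, fun x => by simp [eval_finsetSum, hf, sumAt]⟩

lemma Regular.distribute {F : Family ι r} (hF : Regular F) (V : List ι) :
    Regular (distribute V F) := by
  induction V with
  | nil => exact hF
  | cons i V ih => exact ih.sumAt_one i

lemma regular_minorFamily {A : Matrix ι ι ℂ} (hA : A.IsHermitian) :
    Regular (minorFamily A r) where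
  conj_apply B z := by simp [minorFamily, map_prod, principalMinor_conj A hA]
  continuous B := by
    unfold minorFamily
    exact continuous_finsetProd _ fun k _ => continuous_principalMinor A (B k)
  diagonal B := by
    choose f hf using fun k => exists_polynomial_principalMinor A (B k)
    exact ⟨∏ k, f k, fun x => by simp [eval_prod, hf, minorFamily]⟩

lemma Regular.im_eq_zero {F : Family ι r} (hF : Regular F) (B : Fin r → Finset ι) (y : ι → ℝ) :
    (F B fun i => y i).im = 0 :=
  Complex.conj_eq_iff_im.mp (by rw [hF.conj_apply]; simp)

end Families

/-! ### Univariate tools: zeros of stable combinations, partial fractions and the barrier shift. -/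

section Univariate

/-- A polynomial without roots near `b` cannot be much smaller at `b` than at `a`. -/
lemma norm_eval_mul_pow_le {f : ℂ[X]} {D : ℕ} (hD : f.natDegree ≤ D) {a b : ℂ} {δ : ℝ}
    (hδ : 0 < δ) (h : ∀ w, f.eval w = 0 → δ ≤ ‖b - w‖) :
    ‖f.eval a‖ * (δ / (δ + ‖a - b‖)) ^ D ≤ ‖f.eval b‖ := by
  rcases eq_or_ne f 0 with rfl | hf
  · simp
  have hsp := IsAlgClosed.splits f
  set q := δ / (δ + ‖a - b‖) with hq
  have hq0 : 0 ≤ q := by positivity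
  have hq1 : q ≤ 1 := div_le_one_of_le₀ (by linarith [norm_nonneg (a - b)]) (by positivity)
  have key : ∀ s : Multiset ℂ, (∀ w ∈ s, δ ≤ ‖b - w‖) →
      ‖(s.map fun w => a - w).prod‖ * q ^ s.card ≤ ‖(s.map fun w => b - w).prod‖ := by
    intro s
    induction s using Multiset.induction_on with
    | empty => simp
    | cons w s ih =>
      intro hs
      have h1 := ih fun v hv => hs v (Multiset.mem_cons_of_mem hv)
      -- For each root, `‖a - w‖/‖b - w‖ ≤ 1 + ‖a - b‖/δ = 1/q` by the triangle inequality.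
      have h2 : ‖a - w‖ * q ≤ ‖b - w‖ := by
        have h3 := hs w (Multiset.mem_cons_self w s)
        have h4 : ‖a - w‖ ≤ ‖a - b‖ + ‖b - w‖ := norm_sub_le_norm_sub_add_norm_sub a b w
        rw [hq, mul_div_assoc', div_le_iff₀ (by positivity)]
        nlinarith [norm_nonneg (a - b)]
      simp only [Multiset.map_cons, Multiset.prod_cons, norm_mul, Multiset.card_cons, pow_succ]
      calc ‖a - w‖ * ‖(s.map fun w => a - w).prod‖ * (q ^ s.card * q)
          = (‖a - w‖ * q) * (‖(s.map fun w => a - w).prod‖ * q ^ s.card) := by ring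
        _ ≤ _ := mul_le_mul h2 h1 (by positivity) (norm_nonneg _)
  rw [hsp.eval_eq_prod_roots, hsp.eval_eq_prod_roots, norm_mul, norm_mul, mul_assoc]
  refine mul_le_mul_of_nonneg_left ?_ (norm_nonneg _)
  refine le_trans ?_ (key f.roots fun w hw => h w (mem_roots'.mp hw).2)
  exact mul_le_mul_of_nonneg_left
    (pow_le_pow_of_le_one hq0 hq1 ((card_roots' f).trans hD)) (norm_nonneg _)

/-- Deform `f + g` to `g` through `(1-s)f + g`, whose zeros are all real. The endpoint has the zero
`β > α`, so zeros in `[α, M]` appear at some first parameter `s₀`, at a point `x₀`; neither `s₀ = 0`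
nor `x₀ = α` is possible. But a zero cannot appear suddenly inside the ray: before `s₀` there is no
zero within `x₀ - α` of `x₀`, which keeps the value at `x₀` away from `0`. -/
lemma no_crossing {f g : ℂ[X]}
    (hst : ∀ c d : ℝ, 0 ≤ c → 0 ≤ d → 0 < c + d → ∀ z : ℂ, 0 < z.im →
      c * f.eval z + d * g.eval z ≠ 0)
    (hf : ∀ z, conj (f.eval z) = f.eval (conj z)) (hg : ∀ z, conj (g.eval z) = g.eval (conj z))
    (hfpos : ∃ M : ℝ, ∀ x : ℝ, M < x → 0 < (f.eval (x : ℂ)).re)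
    (hgpos : ∃ M : ℝ, ∀ x : ℝ, M < x → 0 < (g.eval (x : ℂ)).re)
    {ρ : ℝ} (h : ∀ x : ℝ, ρ < x → f.eval (x : ℂ) + g.eval (x : ℂ) ≠ 0) {α β : ℝ} (hα : ρ < α)
    (hαβ : α < β) (hfα : f.eval (α : ℂ) = 0) (hgβ : g.eval (β : ℂ) = 0) : False := by
  obtain ⟨M₁, hM₁⟩ := hfpos
  obtain ⟨M₂, hM₂⟩ := hgpos
  set M := max M₁ M₂ with hM
  have hfim : ∀ x : ℝ, (f.eval (x : ℂ)).im = 0 := fun x =>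
    Complex.conj_eq_iff_im.mp (by rw [hf]; simp)
  have hgim : ∀ x : ℝ, (g.eval (x : ℂ)).im = 0 := fun x =>
    Complex.conj_eq_iff_im.mp (by rw [hg]; simp)
  set F : ℝ → ℝ := fun x => (f.eval (x : ℂ)).re with hF
  set G : ℝ → ℝ := fun x => (g.eval (x : ℂ)).re with hG
  have hFc : Continuous F := by
    exact Complex.continuous_re.comp (f.continuous.comp Complex.continuous_ofReal)
  have hGc : Continuous G := by
    exact Complex.continuous_re.comp (g.continuous.comp Complex.continuous_ofReal)
  have hFM : ∀ x, M < x → 0 < F x := fun x hx => hM₁ x ((le_max_left _ _).trans_lt hx)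
  have hGM : ∀ x, M < x → 0 < G x := fun x hx => hM₂ x ((le_max_right _ _).trans_lt hx)
  have hpos : ∀ x, ρ < x → 0 < F x + G x := by
    intro x hx
    by_contra hneg
    have h1 : 0 < F (max M x + 1) + G (max M x + 1) := by
      have : M < max M x + 1 := by linarith [le_max_left M x]
      exact add_pos (hFM _ this) (hGM _ this)
    have hle : x ≤ max M x + 1 := by linarith [le_max_right M x]
    obtain ⟨y, hy, hy0⟩ := intermediate_value_Icc hle
      ((hFc.add hGc).continuousOn) ⟨not_lt.mp hneg, h1.le⟩
    refine h y (hx.trans_le hy.1) (Complex.ext ?_ ?_)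
    · simpa [hF, hG] using hy0
    · simp [hfim, hgim]
  have hFα : F α = 0 := by simp [hF, hfα]
  have hGβ : G β = 0 := by simp [hG, hgβ]
  have hβM : β ≤ M := by
    by_contra hc
    exact (hGM β (not_le.mp hc)).ne' hGβ
  let k : ℝ → ℝ → ℝ := fun s x => (1 - s) * F x + G x
  let K : Set (ℝ × ℝ) := (Set.Icc 0 1 ×ˢ Set.Icc α M) ∩ {p | k p.1 p.2 = 0}
  have hkc : Continuous fun p : ℝ × ℝ => k p.1 p.2 := by
    simp only [k]; fun_prop
  have hK : IsCompact K := (isCompact_Icc.prod isCompact_Icc).inter_right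
    (isClosed_eq hkc continuous_const)
  have hKne : K.Nonempty := ⟨(1, β), by simp [K, k, hαβ.le, hβM, hGβ]⟩
  obtain ⟨⟨s₀, x₀⟩, ⟨⟨hs₀, hx₀⟩, hk₀⟩, hmin⟩ := hK.exists_isMinOn hKne continuous_fst.continuousOn
  simp only [Set.mem_ofPred_eq, k] at hk₀ hs₀ hx₀
  have hs₀pos : 0 < s₀ := by
    rcases hs₀.1.lt_or_eq with h1 | h1
    · exact h1
    · exfalso
      rw [← h1] at hk₀
      have := hpos x₀ (hα.trans_le hx₀.1)
      linarith
  have hx₀α : α < x₀ := by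
    rcases hx₀.1.lt_or_eq with h1 | h1
    · exact h1
    · exfalso
      rw [← h1, hFα] at hk₀
      have := hpos α hα
      rw [hFα] at this
      linarith
  have hδ : 0 < x₀ - α := by linarith
  set q := ((x₀ - α) / (x₀ - α + ‖(α : ℂ) - x₀‖)) ^ (max f.natDegree g.natDegree) with hq
  have hq0 : 0 < q := by positivity
  -- The lower bound is uniform in `s` because the value at `α` is always `G α`. A zero in the disc
  -- would be real, to the right of `α` and at most `M`, contradicting the minimality of `s₀`.
  have hbound : ∀ s ∈ Set.Ioo 0 s₀, G α * q ≤ |(1 - s) * F x₀ + G x₀| := by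
    intro s hs
    have hs1 : 0 ≤ 1 - s := by linarith [hs.2, hs₀.2]
    set p : ℂ[X] := C ((1 - s : ℝ) : ℂ) * f + g with hp
    have hpd : p.natDegree ≤ max f.natDegree g.natDegree :=
      (natDegree_add_le _ _).trans (max_le_max (natDegree_C_mul_le _ _) le_rfl)
    have hpe : ∀ z, p.eval z = ((1 - s : ℝ) : ℂ) * f.eval z + g.eval z := by
      intro z; simp [hp]
    have hre : ∀ x : ℝ, p.eval (x : ℂ) = (((1 - s) * F x + G x : ℝ) : ℂ) := by
      intro x
      rw [hpe]
      apply Complex.ext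
      · rw [Complex.add_re, Complex.re_ofReal_mul, Complex.ofReal_re]
      · rw [Complex.add_im, Complex.im_ofReal_mul, Complex.ofReal_im, hfim, hgim]; ring
    have hH : ∀ z : ℂ, 0 < z.im → p.eval z ≠ 0 := by
      intro z hz
      have := hst (1 - s) 1 hs1 zero_le_one (by linarith) z hz
      simpa [hpe] using this
    have hroots : ∀ w, p.eval w = 0 → x₀ - α ≤ ‖(x₀ : ℂ) - w‖ := by
      intro w hw
      by_contra hlt
      rw [not_le] at hlt
      have him : w.im = 0 := by
        rcases lt_trichotomy w.im 0 with h1 | h1 | h1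
        · exfalso
          refine hH (conj w) (by simpa using h1) ?_
          have : p.eval (conj w) = conj (p.eval w) := by
            rw [hpe, hpe, map_add, map_mul, hf, hg, Complex.conj_ofReal]
          rw [this, hw, map_zero]
        · exact h1
        · exact absurd hw (hH w h1)
      obtain ⟨u, rfl⟩ : ∃ u : ℝ, w = u := ⟨w.re, Complex.ext rfl (by simpa using him)⟩
      rw [← Complex.ofReal_sub, Complex.norm_real, Real.norm_eq_abs] at hlt
      have hu : α < u := by linarith [le_abs_self (x₀ - u)]
      rw [hre, Complex.ofReal_eq_zero] at hw
      have huM : u ≤ M := by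
        by_contra hc
        rw [not_le] at hc
        have := hFM u hc
        have := hGM u hc
        nlinarith
      have hmem : (s, u) ∈ K := by
        refine ⟨⟨⟨hs.1.le, by linarith⟩, ⟨hu.le, huM⟩⟩, hw⟩
      have := hmin hmem
      simp only [Set.mem_ofPred_eq] at this
      linarith [hs.2]
    have := norm_eval_mul_pow_le (a := (α : ℂ)) hpd hδ hroots
    rw [hre, hre, Complex.norm_real, Complex.norm_real, hFα, mul_zero, zero_add,
      Real.norm_eq_abs, Real.norm_eq_abs] at this
    exact (mul_le_mul_of_nonneg_right (le_abs_self _) hq0.le).trans this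
  have hlim : Tendsto (fun s : ℝ => |(1 - s) * F x₀ + G x₀|) (𝓝[<] s₀) (𝓝 0) := by
    have hc : Continuous fun s : ℝ => |(1 - s) * F x₀ + G x₀| := by fun_prop
    have := hc.tendsto s₀
    rw [hk₀, abs_zero] at this
    exact this.mono_left nhdsWithin_le_nhds
  have hle := ge_of_tendsto hlim (by
    filter_upwards [Ioo_mem_nhdsLT hs₀pos] with s hs using hbound s hs)
  have hGα := hpos α hα
  rw [hFα, zero_add] at hGα
  exact absurd hle (not_le.mpr (mul_pos hGα hq0))

/-- Split off one polynomial from the sum of the others. If both pieces had zeros above `ρ`, these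
would either coincide, giving a zero of the total, or be ordered as `no_crossing` forbids. So one
piece is zero-free there, and induction treats the sum of the others. -/
lemma exists_forall_eval_ne_zero {κ : Type*} [DecidableEq κ] (f : κ → ℂ[X])
    (hf : ∀ k z, conj ((f k).eval z) = (f k).eval (conj z))
    (hpos : ∀ k, ∃ M : ℝ, ∀ x : ℝ, M < x → 0 < ((f k).eval (x : ℂ)).re) {ρ : ℝ}
    {s : Finset κ} (hs : s.Nonempty)
    (hst : ∀ c : κ → ℝ, (∀ k, 0 ≤ c k) → (∃ k ∈ s, 0 < c k) → ∀ z : ℂ, 0 < z.im →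
      ∑ k ∈ s, c k * (f k).eval z ≠ 0)
    (h : ∀ x : ℝ, ρ < x → ∑ k ∈ s, (f k).eval (x : ℂ) ≠ 0) :
    ∃ k ∈ s, ∀ x : ℝ, ρ < x → (f k).eval (x : ℂ) ≠ 0 := by
  induction hs using Finset.Nonempty.cons_induction with
  | singleton a => exact ⟨a, by simp, by simpa using h⟩
  | cons a s ha hs ih =>
    set g : ℂ[X] := ∑ k ∈ s, f k with hg
    have hge : ∀ z, g.eval z = ∑ k ∈ s, (f k).eval z := fun z => by rw [hg, eval_finsetSum]
    have hst' : ∀ c d : ℝ, 0 ≤ c → 0 ≤ d → 0 < c + d → ∀ z : ℂ, 0 < z.im →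
        c * (f a).eval z + d * g.eval z ≠ 0 := by
      intro c d hc hd hcd z hz
      have h1 := hst (fun k => if k = a then c else d) (fun k => by split_ifs <;> assumption) (by
        rcases hc.lt_or_eq with h | h
        · exact ⟨a, by simp, by simpa using h⟩
        · obtain ⟨b, hb⟩ := hs
          have : b ≠ a := by rintro rfl; exact ha hb
          exact ⟨b, by simp [hb], by simp [this]; linarith⟩) z hz
      rw [Finset.sum_cons] at h1
      convert h1 using 2
      · simp
      · rw [hge, Finset.mul_sum]
        refine Finset.sum_congr rfl fun k hk => ?_
        have : k ≠ a := by rintro rfl; exact ha hk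
        simp [this]
    have hgc : ∀ z, conj (g.eval z) = g.eval (conj z) := fun z => by
      simp only [hge, map_sum, hf]
    have hgpos : ∃ M : ℝ, ∀ x : ℝ, M < x → 0 < (g.eval (x : ℂ)).re := by
      choose M hM using hpos
      refine ⟨s.sup' hs M, fun x hx => ?_⟩
      rw [hge, Complex.re_sum]
      exact Finset.sum_pos (fun k hk => hM k x ((Finset.le_sup' M hk).trans_lt hx)) hs
    have hsum : ∀ x : ℝ, ρ < x → (f a).eval (x : ℂ) + g.eval (x : ℂ) ≠ 0 := by
      intro x hx
      have := h x hx
      rwa [Finset.sum_cons, ← hge] at this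
    by_cases h1 : ∀ x : ℝ, ρ < x → (f a).eval (x : ℂ) ≠ 0
    · exact ⟨a, by simp, h1⟩
    by_cases h2 : ∀ x : ℝ, ρ < x → g.eval (x : ℂ) ≠ 0
    · obtain ⟨k, hk, hk'⟩ := ih (fun c hc hc' z hz => by
        have h3 := hst (fun k => if k = a then 0 else c k)
          (fun k => by split_ifs; exacts [le_rfl, hc k])
          (by
            obtain ⟨b, hb, hb'⟩ := hc'
            have : b ≠ a := by rintro rfl; exact ha hb
            exact ⟨b, by simp [hb], by simpa [this] using hb'⟩) z hz
        rw [Finset.sum_cons] at h3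
        convert h3 using 1
        simp only [if_true, Complex.ofReal_zero, zero_mul, zero_add]
        refine Finset.sum_congr rfl fun k hk => ?_
        have : k ≠ a := by rintro rfl; exact ha hk
        simp [this]) (fun x hx => by rw [← hge]; exact h2 x hx)
      exact ⟨k, by simp [hk], hk'⟩
    push Not at h1 h2
    obtain ⟨α, hα, hα0⟩ := h1
    obtain ⟨β, hβ, hβ0⟩ := h2
    rcases lt_trichotomy α β with hlt | rfl | hlt
    · exact (no_crossing hst' (hf a) hgc (hpos a) hgpos hsum hα hlt hα0 hβ0).elim
    · exact absurd (by rw [hα0, hβ0, add_zero]) (hsum α hα)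
    · refine (no_crossing (fun c d hc hd hcd z hz => ?_) hgc (hf a) hgpos (hpos a)
        (fun x hx => ?_) hβ hlt hβ0 hα0).elim
      · rw [add_comm]; exact hst' d c hd hc (by linarith) z hz
      · rw [add_comm]; exact hsum x hx

/-- Approach `a` along the ray of angle `θ`. With `m` the multiplicity, the leading term of the
imaginary part is a negative multiple of `sin(mθ)` times a fixed real number, and for `m ≥ 2` this
changes sign on `(0, π)`. -/
lemma rootMultiplicity_eq_one_of_im_nonpos {P Q : ℝ[X]} (hP : P ≠ 0)
    (hPQ : ∀ z : ℂ, 0 < z.im → (aeval z Q * conj (aeval z P)).im ≤ 0) {a : ℝ}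
    (ha : P.eval a = 0) (hQ : Q.eval a ≠ 0) :
    P.rootMultiplicity a = 1 ∧ 0 < Q.eval a * (derivative P).eval a := by
  obtain ⟨P₂, hP₂, hdvd⟩ := exists_eq_pow_rootMultiplicity_mul_and_not_dvd P hP a
  set m := P.rootMultiplicity a with hm
  have hm0 : 0 < m := (rootMultiplicity_pos hP).mpr ha
  have hP₂a : P₂.eval a ≠ 0 := fun h => hdvd (dvd_iff_isRoot.mpr h)
  set K := Q.eval a * P₂.eval a with hK
  have key : ∀ θ : ℝ, 0 < θ → θ < Real.pi → 0 ≤ Real.sin (m * θ) * K := by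
    intro θ h0 hπ
    set u : ℂ := Complex.exp (θ * Complex.I) with hu
    have huim : u.im = Real.sin θ := Complex.exp_ofReal_mul_I_im θ
    let w : ℝ → ℂ := fun η => aeval ((a : ℂ) + η * u) Q * conj (aeval ((a : ℂ) + η * u) P₂) *
      conj (u ^ m)
    have hw : ∀ η : ℝ, 0 < η → (w η).im ≤ 0 := by
      intro η hη
      have h1 := hPQ (a + η * u) (by
        simp only [Complex.add_im, Complex.ofReal_im, zero_add, Complex.im_ofReal_mul, huim]
        exact mul_pos hη (Real.sin_pos_of_pos_of_lt_pi h0 hπ))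
      have h2 : aeval ((a : ℂ) + η * u) Q * conj (aeval ((a : ℂ) + η * u) P) =
          ((η ^ m : ℝ) : ℂ) * w η := by
        conv_lhs => rw [hP₂]
        simp only [w, map_mul, map_pow, map_sub, aeval_X, aeval_C, Complex.coe_algebraMap,
          add_sub_cancel_left, Complex.conj_ofReal, Complex.ofReal_pow]
        ring
      rw [h2, Complex.im_ofReal_mul] at h1
      exact nonpos_of_mul_nonpos_right h1 (pow_pos hη m)
    have hcont : Continuous w := by
      have h3 : ∀ R : ℝ[X], Continuous fun η : ℝ => aeval ((a : ℂ) + η * u) R := fun R =>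
        (Polynomial.continuous_aeval R).comp (by fun_prop)
      exact ((h3 Q).mul (Complex.continuous_conj.comp (h3 P₂))).mul continuous_const
    have hlim : (w 0).im ≤ 0 := by
      have ht : Tendsto (fun η => (w η).im) (𝓝[>] 0) (𝓝 (w 0).im) :=
        ((Complex.continuous_im.comp hcont).tendsto 0).mono_left nhdsWithin_le_nhds
      refine le_of_tendsto ht ?_
      filter_upwards [self_mem_nhdsWithin] with η hη using hw η hη
    have hum : u ^ m = Complex.exp ((m * θ : ℝ) * Complex.I) := by
      rw [hu, ← Complex.exp_nat_mul]; push_cast; ring_nf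
    have hval : ∀ R : ℝ[X], aeval (a : ℂ) R = ((R.eval a : ℝ) : ℂ) := fun R => by
      have := aeval_algebraMap_apply ℂ a R
      simpa using this
    have hw0 : (w 0).im = -(Real.sin (m * θ) * K) := by
      simp only [w, Complex.ofReal_zero, zero_mul, add_zero, hval, Complex.conj_ofReal, hum]
      rw [← Complex.ofReal_mul, Complex.im_ofReal_mul, Complex.conj_im,
        Complex.exp_ofReal_mul_I_im]
      ring
    linarith
  have hK0 : K ≠ 0 := mul_ne_zero hQ hP₂a
  have hmR : (0 : ℝ) < m := by exact_mod_cast hm0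
  have hm1R : (1 : ℝ) ≤ m := by exact_mod_cast hm0
  have hKpos : 0 < K := by
    have h1 := key (Real.pi / (2 * m)) (by positivity) (by
      rw [div_lt_iff₀ (by positivity)]; nlinarith [Real.pi_pos])
    have h2 : (m : ℝ) * (Real.pi / (2 * m)) = Real.pi / 2 := by field_simp
    rw [h2, Real.sin_pi_div_two, one_mul] at h1
    exact lt_of_le_of_ne h1 hK0.symm
  have hm1 : m = 1 := by
    by_contra hne
    have hm2 : (2 : ℝ) ≤ m := by exact_mod_cast (by omega : 2 ≤ m)
    -- This angle is below `π` exactly because `m ≥ 2`, and `sin(mθ) = -1` there.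
    have h1 := key (3 * Real.pi / (2 * m)) (by positivity) (by
      rw [div_lt_iff₀ (by positivity)]; nlinarith [Real.pi_pos])
    have h2 : (m : ℝ) * (3 * Real.pi / (2 * m)) = Real.pi / 2 + Real.pi := by field_simp; ring
    rw [h2, Real.sin_add_pi, Real.sin_pi_div_two] at h1
    linarith
  refine ⟨hm1, ?_⟩
  have : (derivative P).eval a = P₂.eval a := by
    rw [hP₂, hm1, pow_one, derivative_mul, derivative_X_sub_C]
    simp
  rwa [this]

/-- The sign condition says that `Q/P` maps the upper half plane into the closed lower one. Once
common roots are removed, `Q = C₀ P + ∑ c_a P/(X - a)` with every `c_a` positive. Nonnegativity of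
`N Q` thus only needs checking on the quotients `P/(X - a)`. -/
lemma nonneg_of_partial_fractions (n : ℕ) : ∀ (P Q : ℝ[X]), P.natDegree = n → P.Splits → P ≠ 0 →
    Q.natDegree ≤ n → (∀ z : ℂ, 0 < z.im → (aeval z Q * conj (aeval z P)).im ≤ 0) →
    ∀ N : ℝ[X] →ₗ[ℝ] ℝ, N P = 0 → (∀ (R : ℝ[X]) (a : ℝ), P = (X - C a) * R → 0 ≤ N R) →
      0 ≤ N Q := by
  induction n with
  | zero =>
    intro P Q hd _ hP hQ _ N hN _
    rw [natDegree_eq_zero] at hd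
    obtain ⟨p, rfl⟩ := hd
    obtain ⟨q, rfl⟩ := natDegree_eq_zero.mp (Nat.le_zero.mp hQ)
    have hp : p ≠ 0 := by rintro rfl; simp at hP
    have : (C q : ℝ[X]) = (q / p) • C p := by
      rw [smul_C, smul_eq_mul, div_mul_cancel₀ _ hp]
    rw [this, map_smul, hN, smul_zero]
  | succ n ih =>
    intro P Q hd hs hP hQ hPQ N hN hR
    by_cases hcommon : ∃ a, P.eval a = 0 ∧ Q.eval a = 0
    · obtain ⟨a, hPa, hQa⟩ := hcommon
      obtain ⟨P₁, rfl⟩ := dvd_iff_isRoot.mpr hPa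
      obtain ⟨Q₁, rfl⟩ := dvd_iff_isRoot.mpr hQa
      have hP₁ : P₁ ≠ 0 := right_ne_zero_of_mul hP
      have hdeg : P₁.natDegree = n := by
        rw [natDegree_mul (X_sub_C_ne_zero a) hP₁, natDegree_X_sub_C] at hd; omega
      have hdegQ : Q₁.natDegree ≤ n := by
        rcases eq_or_ne Q₁ 0 with rfl | h
        · simp
        · rw [natDegree_mul (X_sub_C_ne_zero a) h, natDegree_X_sub_C] at hQ; omega
      -- A common root is divided out of both polynomials and absorbed into the functional. On the
      -- upper half plane the sign condition only loses the positive factor `|z - a|²`.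
      refine ih P₁ Q₁ hdeg (splits_X_sub_C_mul_iff.mp hs) hP₁ hdegQ (fun z hz => ?_)
        (N ∘ₗ LinearMap.mulLeft ℝ (X - C a)) (by simpa using hN) (fun R b hb => ?_)
      · have h1 := hPQ z hz
        have h2 : aeval z ((X - C a) * Q₁) * conj (aeval z ((X - C a) * P₁)) =
            ((‖z - a‖ ^ 2 : ℝ) : ℂ) * (aeval z Q₁ * conj (aeval z P₁)) := by
          simp only [map_mul, map_sub, aeval_X, aeval_C, Complex.coe_algebraMap,
            Complex.ofReal_pow, ← Complex.mul_conj']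
          ring
        rw [h2, Complex.im_ofReal_mul] at h1
        refine nonpos_of_mul_nonpos_right h1 (pow_pos (norm_pos_iff.mpr fun h => ?_) 2)
        have := congrArg Complex.im h
        simp at this
        exact hz.ne' this
      · refine hR _ b ?_
        rw [hb, LinearMap.mulLeft_apply]; ring
    · push Not at hcommon
      have hsimple := fun a (ha : P.eval a = 0) =>
        rootMultiplicity_eq_one_of_im_nonpos hP hPQ ha (hcommon a ha)
      have hnodup : P.roots.Nodup := by
        rw [Multiset.nodup_iff_count_le_one]
        intro a
        rw [count_roots]
        by_cases ha : P.eval a = 0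
        · exact (hsimple a ha).1.le
        · rw [rootMultiplicity_eq_zero ha]; exact zero_le_one
      set s := P.roots.toFinset with hsdef
      have hcard : s.card = n + 1 := by
        rw [hsdef, Multiset.toFinset_card_of_nodup hnodup, ← hs.natDegree_eq_card_roots, hd]
      have hmem : ∀ a ∈ s, P.eval a = 0 := fun a ha =>
        (mem_roots'.mp (Multiset.mem_toFinset.mp ha)).2
      let R : ℝ → ℝ[X] := fun a => P /ₘ (X - C a)
      have hRP : ∀ a ∈ s, P = (X - C a) * R a := fun a ha =>
        (mul_divByMonic_eq_iff_isRoot.mpr (hmem a ha)).symm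
      have hRa : ∀ a ∈ s, (R a).eval a = (derivative P).eval a := by
        intro a ha
        conv_rhs => rw [hRP a ha]
        rw [derivative_mul, derivative_X_sub_C]; simp
      have hRb : ∀ a ∈ s, ∀ b ∈ s, a ≠ b → (R a).eval b = 0 := by
        intro a ha b hb hab
        have := hmem b hb
        rw [hRP a ha, eval_mul, eval_sub, eval_X, eval_C] at this
        exact (mul_eq_zero.mp this).resolve_left (sub_ne_zero.mpr hab.symm)
      have hRdeg : ∀ a, (R a).natDegree = n := by
        intro a
        rw [natDegree_divByMonic _ (monic_X_sub_C a), hd, natDegree_X_sub_C]; rfl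
      set c : ℝ → ℝ := fun a => Q.eval a / (derivative P).eval a with hc
      have hc0 : ∀ a ∈ s, 0 < c a := fun a ha => by
        have := (hsimple a (hmem a ha)).2
        rcases pos_and_pos_or_neg_and_neg_of_mul_pos this with ⟨h1, h2⟩ | ⟨h1, h2⟩
        · exact div_pos h1 h2
        · exact div_pos_of_neg_of_neg h1 h2
      have hlead : P.coeff (n + 1) ≠ 0 := by
        rw [← hd]; exact leadingCoeff_ne_zero.mpr hP
      set C₀ := Q.coeff (n + 1) / P.coeff (n + 1) with hC₀
      -- Lagrange interpolation: `C₀` matches the top coefficient, leaving degree at most `n`, and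
      -- both sides agree at the `n + 1` simple roots.
      have hQeq : Q = C₀ • P + ∑ a ∈ s, c a • R a := by
        rw [← sub_eq_zero]
        refine eq_zero_of_degree_lt_of_eval_finset_eq_zero s ?_ ?_
        · rw [hcard, degree_lt_iff_coeff_zero]
          intro m hm
          have hRm : ∀ a, (R a).coeff m = 0 := fun a =>
            coeff_eq_zero_of_natDegree_lt (by rw [hRdeg]; omega)
          simp only [coeff_sub, coeff_add, coeff_smul, finsetSum_coeff, hRm, mul_zero,
            Finset.sum_const_zero, add_zero, smul_eq_mul]
          rcases hm.eq_or_lt with rfl | hlt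
          · rw [hC₀, div_mul_cancel₀ _ hlead, sub_self]
          · rw [coeff_eq_zero_of_natDegree_lt (hQ.trans_lt hlt),
              coeff_eq_zero_of_natDegree_lt (by rw [hd]; exact hlt)]
            simp
        · intro b hb
          simp only [eval_sub, eval_add, eval_smul, eval_finsetSum, hmem b hb, mul_zero, zero_add,
            smul_eq_mul]
          rw [Finset.sum_eq_single b (fun a ha hab => by rw [hRb a ha b hb hab, mul_zero])
            (fun h => absurd hb h), hRa b hb, hc, div_mul_cancel₀, sub_self]
          intro h0
          have := (hsimple b (hmem b hb)).2
          rw [h0, mul_zero] at this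
          exact lt_irrefl _ this
      rw [hQeq, map_add, map_smul, hN, smul_zero, zero_add, map_sum]
      refine Finset.sum_nonneg fun a ha => ?_
      rw [map_smul]
      exact smul_nonneg (hc0 a ha).le (hR _ a (hRP a ha))

lemma sq_card_le_sum_mul_sum_inv (s : Multiset ℝ) (hs : ∀ y ∈ s, 0 < y) :
    0 ≤ s.sum ∧ 0 ≤ (s.map fun y => y⁻¹).sum ∧
      (s.card : ℝ) ^ 2 ≤ s.sum * (s.map fun y => y⁻¹).sum := by
  induction s using Multiset.induction_on with
  | empty => simp
  | cons y s ih =>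
    obtain ⟨h1, h2, h3⟩ := ih fun x hx => hs x (Multiset.mem_cons_of_mem hx)
    have hy := hs y (Multiset.mem_cons_self y s)
    have hy' : 0 < y⁻¹ := inv_pos.mpr hy
    simp only [Multiset.sum_cons, Multiset.map_cons, Multiset.card_cons]
    refine ⟨by positivity, by positivity, ?_⟩
    set S := s.sum
    set T := (s.map fun y => y⁻¹).sum
    have hyy : y * y⁻¹ = 1 := mul_inv_cancel₀ hy.ne'
    have h4 : 2 * (s.card : ℝ) ≤ S * y⁻¹ + y * T := by
      refine abs_le_of_sq_le_sq' ?_ (by positivity) |>.2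
      have : (S * y⁻¹) * (y * T) = S * T := by
        calc (S * y⁻¹) * (y * T) = S * T * (y * y⁻¹) := by ring
          _ = S * T := by rw [hyy, mul_one]
      nlinarith [sq_nonneg (S * y⁻¹ - y * T)]
    push_cast
    nlinarith

/-- The barrier estimate in one variable. -/
lemma topPolar_barrier {r : ℕ} (hr : 0 < r) {P Q : ℝ[X]} (hs : P.Splits) (hd : P.natDegree ≤ r)
    (hc : 0 < P.coeff r) (hQ : Q.natDegree ≤ r)
    (hPQ : ∀ z : ℂ, 0 < z.im → (aeval z Q * conj (aeval z P)).im ≤ 0) {x φ : ℝ} (hφ : 0 < φ)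
    (hx : ∀ t, x ≤ t → 0 < P.eval t) (hφx : (derivative P).eval x ≤ φ * P.eval x) :
    0 < topPolar r P (x - (r - 1) ^ 2 / (r * φ)) ∧
      topPolar r Q (x - (r - 1) ^ 2 / (r * φ)) * P.eval x ≤
        Q.eval x * topPolar r P (x - (r - 1) ^ 2 / (r * φ)) := by
  set Δ := ((r : ℝ) - 1) ^ 2 / (r * φ) with hΔ
  have hrR : (0 : ℝ) < r := by exact_mod_cast hr
  have hrΔ : r * Δ * φ = (r - 1) ^ 2 := by rw [hΔ]; field_simp
  have hP0 : P ≠ 0 := by rintro rfl; simp at hc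
  have hdeg : P.natDegree = r := natDegree_eq_of_le_of_coeff_ne_zero hd hc.ne'
  have hPx := hx x le_rfl
  have hroot : ∀ a ∈ P.roots, 0 < x - a := by
    intro a ha
    by_contra h
    exact (hx a (by linarith)).ne' (mem_roots'.mp ha).2
  obtain ⟨hcard, hpol⟩ := topPolar_eq_sum_roots hr hs hd hc.ne' (x - Δ)
  have hpol' : topPolar r P (x - Δ) =
      P.coeff r * ((P.roots.map fun a => x - a).sum - r * Δ) := by
    rw [hpol]
    congr 1
    have : (fun a => x - Δ - a) = fun a => (x - a) - Δ := by funext a; ring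
    rw [this, Multiset.sum_map_sub]
    simp [hcard]
  have hder : (P.roots.map fun a => (x - a)⁻¹).sum ≤ φ := by
    have h1 := hs.eval_derivative_div_eval_of_ne_zero hPx.ne'
    have h2 : (derivative P).eval x / P.eval x ≤ φ := (div_le_iff₀ hPx).mpr hφx
    rw [h1] at h2
    simpa [one_div] using h2
  have hsub : ∀ s : Multiset ℝ, (∀ a ∈ s, 0 < x - a) → (s.map fun a => (x - a)⁻¹).sum ≤ φ →
      (s.card : ℝ) ^ 2 ≤ (s.map fun a => x - a).sum * φ := by
    intro s hs hsφ
    obtain ⟨h1, h2, h3⟩ := sq_card_le_sum_mul_sum_inv (s.map fun a => x - a) (by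
      intro y hy
      obtain ⟨a, ha, rfl⟩ := Multiset.mem_map.mp hy
      exact hs a ha)
    rw [Multiset.card_map, Multiset.map_map] at h3
    exact h3.trans (mul_le_mul_of_nonneg_left hsφ h1)
  -- Cauchy–Schwarz over all `r` roots gives `r² ≤ φ ∑ (x - a)`, strictly more than `rΔφ = (r-1)²`.
  have hpos : 0 < topPolar r P (x - Δ) := by
    rw [hpol']
    refine mul_pos hc ?_
    have h1 := hsub P.roots hroot hder
    rw [hcard] at h1
    have hr1 : (1 : ℝ) ≤ r := by exact_mod_cast hr
    have : 0 < ((P.roots.map fun a => x - a).sum - r * Δ) * φ := by nlinarith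
    exact pos_of_mul_pos_left this hφ.le
  refine ⟨hpos, ?_⟩
  -- The functional is the desired inequality itself. On `P/(X - a)` it is a nonnegative multiple of
  -- `∑ (x - b) - rΔ` over the other `r - 1` roots. Cauchy–Schwarz for those roots gives `(r-1)² ≤ φ
  -- ∑ (x - b)`, which dictates the size of `Δ`.
  let N : ℝ[X] →ₗ[ℝ] ℝ :=
    { toFun := fun R => R.eval x * topPolar r P (x - Δ) - topPolar r R (x - Δ) * P.eval x
      map_add' := fun R S => by simp only [eval_add, topPolar, coeff_add]; ring
      map_smul' := fun c R => by
        simp only [eval_smul, topPolar, coeff_smul, smul_eq_mul, RingHom.id_apply]; ring }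
  have hN := nonneg_of_partial_fractions r P Q hdeg hs hP0 hQ hPQ N
    (by simp only [N, LinearMap.coe_mk, AddHom.coe_mk]; ring) (fun R a hR => by
      have hR0 : R ≠ 0 := by rintro rfl; simp at hR; exact hP0 hR
      have hRdeg : R.natDegree + 1 = r := by
        rw [hR, natDegree_mul (X_sub_C_ne_zero a) hR0, natDegree_X_sub_C] at hdeg; omega
      have hRr : R.coeff r = 0 := coeff_eq_zero_of_natDegree_lt (by omega)
      have hRlead : R.coeff (r - 1) = P.coeff r := by
        have h1 : R.coeff (r - 1) = R.leadingCoeff := by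
          rw [leadingCoeff]; congr 1; omega
        have h2 : P.coeff r = P.leadingCoeff := by rw [leadingCoeff, hdeg]
        rw [h1, h2, hR, leadingCoeff_mul, leadingCoeff_X_sub_C, one_mul]
      have hroots : P.roots = a ::ₘ R.roots := by
        conv_lhs => rw [hR]
        rw [roots_mul (mul_ne_zero (X_sub_C_ne_zero a) hR0), roots_X_sub_C,
          Multiset.singleton_add]
      have hxa : 0 < x - a := hroot a (by rw [hroots]; exact Multiset.mem_cons_self _ _)
      have hPR : P.eval x = (x - a) * R.eval x := by
        conv_lhs => rw [hR]
        simp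
      have hRx : 0 < R.eval x := pos_of_mul_pos_right (hPR ▸ hPx) hxa.le
      have hRcard : (R.roots.card : ℝ) = r - 1 := by
        have := hcard
        rw [hroots, Multiset.card_cons] at this
        rw [← this]; push_cast; ring
      have h1 := hsub R.roots
        (fun b hb => hroot b (by rw [hroots]; exact Multiset.mem_cons_of_mem hb)) (by
          rw [hroots, Multiset.map_cons, Multiset.sum_cons] at hder
          have : 0 < (x - a)⁻¹ := inv_pos.mpr hxa
          linarith)
      rw [hRcard, ← hrΔ] at h1
      have h2 : r * Δ ≤ (R.roots.map fun b => x - b).sum := le_of_mul_le_mul_right h1 hφ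
      change 0 ≤ R.eval x * topPolar r P (x - Δ) - topPolar r R (x - Δ) * P.eval x
      have h3 : topPolar r R (x - Δ) = P.coeff r := by
        rw [topPolar, hRr, hRlead]; ring
      rw [h3, hpol', hPR, hroots, Multiset.map_cons, Multiset.sum_cons]
      have : 0 ≤ R.eval x * P.coeff r * ((R.roots.map fun b => x - b).sum - r * Δ) :=
        mul_nonneg (mul_nonneg hRx.le hc.le) (by linarith)
      linarith)
  simp only [N, LinearMap.coe_mk, AddHom.coe_mk] at hN
  linarith

end Univariate

/-! ### The multivariate barrier and its behavior under distribution. -/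

section Barrier

variable {ι : Type*} [Fintype ι] [DecidableEq ι] {r : ℕ}

lemma exists_map_ofReal {f : ℂ[X]} (h : ∀ x : ℝ, (f.eval (x : ℂ)).im = 0) :
    ∃ g : ℝ[X], g.map (algebraMap ℝ ℂ) = f := by
  rw [← mem_lifts, lifts_iff_coeff_lifts]
  have hconj : f.map (starRingEnd ℂ) = f := by
    refine eq_of_infinite_eval_eq _ _ (Set.Infinite.mono ?_
      (Set.infinite_range_of_injective Complex.ofReal_injective))
    rintro _ ⟨x, rfl⟩
    have h1 : (f.map (starRingEnd ℂ)).eval (conj (x : ℂ)) = conj (f.eval (x : ℂ)) :=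
      eval_map_apply _ _
    rw [Complex.conj_ofReal] at h1
    change eval (x : ℂ) _ = eval (x : ℂ) _
    rw [h1]
    exact Complex.conj_eq_iff_im.mpr (h x)
  intro n
  have h2 : conj (f.coeff n) = f.coeff n := by
    conv_rhs => rw [← hconj]
    rw [coeff_map]
  exact ⟨(f.coeff n).re, Complex.conj_eq_iff_re.mp h2⟩

lemma splits_of_aeval_ne_zero {P : ℝ[X]} (h : ∀ z : ℂ, 0 < z.im → aeval z P ≠ 0) :
    P.Splits := by
  refine Splits.of_splits_map (algebraMap ℝ ℂ) (IsAlgClosed.splits _) fun a ha => ?_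
  have ha0 : aeval a P = 0 := by
    rw [← eval_map_algebraMap]; exact (mem_roots'.mp ha).2
  refine ⟨a.re, Complex.ext rfl ?_⟩
  rcases lt_trichotomy a.im 0 with h1 | h1 | h1
  · refine absurd ?_ (h (conj a) (by simpa using h1))
    have : aeval (conj a) P = conj (aeval a P) := aeval_conj P a
    rw [this, ha0, map_zero]
  · exact h1.symm
  · exact absurd ha0 (h a h1)

lemma ofReal_update (y : ι → ℝ) (j : ι) (t : ℝ) :
    (fun i => ((Function.update y j t i : ℝ) : ℂ)) =
      Function.update (fun i => (y i : ℂ)) j (t : ℂ) := by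
  ext i; by_cases hi : i = j
  · subst hi; simp
  · simp [hi]

/-- Hurwitz: nonvanishing persists on the boundary in all but one of the variables. -/
lemma Stable.ne_zero_of_im_nonneg {F : Family ι r} {L : List ι} (hF : Stable F L)
    (hreg : Regular F) {i : ι} (hP : Polarizes F i) (hiL : i ∉ L) {B : Fin r → Finset ι}
    (hB : ∀ l ∈ L, ∀ k, l ∉ B k) (hi : ∀ k, i ∉ B k) {z : ι → ℂ} (hz : ∀ l, 0 ≤ (z l).im)
    (hzi : 0 < (z i).im) {a : ℂ} (ha : F (addAll i B) (Function.update z i a) ≠ 0) :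
    F (addAll i B) z ≠ 0 := by
  intro h0
  -- All variables are pushed into the open half plane by `iη`. The degree bound `r` makes the lower
  -- bound from `norm_eval_mul_pow_le` uniform as `η → 0`.
  let w : ℝ → ι → ℂ := fun η l => z l + η * Complex.I
  set q := ((z i).im / ((z i).im + ‖a - z i‖)) ^ r with hq
  have hq0 : 0 < q := by positivity
  have hbound : ∀ η : ℝ, 0 < η → ‖F (addAll i B) (Function.update (w η) i a)‖ * q ≤
      ‖F (addAll i B) (Function.update (w η) i (z i))‖ := by
    intro η hη
    obtain ⟨f, hdeg, heval, -⟩ := hP B hi (w η)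
    have := norm_eval_mul_pow_le (a := a) (b := z i) hdeg hzi (fun v hv => ?_)
    · rwa [heval, heval] at this
    by_contra hlt
    have hvim : 0 < v.im := by
      have h1 := (Complex.abs_im_le_norm (z i - v)).trans_lt (not_le.mp hlt)
      rw [Complex.sub_im] at h1
      have := le_abs_self ((z i).im - v.im)
      linarith
    rw [heval] at hv
    refine hF _ (fun l hl => notMem_addAll (by rintro rfl; exact hiL hl) (hB l hl)) _ ?_ hv
    intro l
    by_cases h : l = i
    · subst h; simpa using hvim
    · have := hz l
      simp [w, h]; linarith
  have hcont : ∀ b : ℂ, Tendsto (fun η : ℝ => ‖F (addAll i B) (Function.update (w η) i b)‖)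
      (𝓝[>] 0) (𝓝 ‖F (addAll i B) (Function.update z i b)‖) := by
    intro b
    have hc : Continuous fun η : ℝ => ‖F (addAll i B) (Function.update (w η) i b)‖ := by
      refine ((hreg.continuous _).comp (Continuous.update ?_ i continuous_const)).norm
      simp only [w]; fun_prop
    have := hc.tendsto 0
    have hw0 : w 0 = z := by ext l; simp [w]
    simp only [hw0] at this
    exact this.mono_left nhdsWithin_le_nhds
  have hle := le_of_tendsto_of_tendsto ((hcont a).mul_const q) (hcont (z i)) (by
    filter_upwards [self_mem_nhdsWithin] with η hη using hbound η hη)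
  rw [Function.update_eq_self, h0, norm_zero] at hle
  exact absurd hle (not_le.mpr (mul_pos (norm_pos_iff.mpr ha) hq0))

/-- Real version of `Polarizes`. -/
lemma Polarizes.exists_real {F : Family ι r} {j : ι} (hP : Polarizes F j) (hreg : Regular F)
    {B : Fin r → Finset ι} (hB : ∀ k, j ∉ B k) (y : ι → ℝ) : ∃ P : ℝ[X],
      P.natDegree ≤ r ∧
      (∀ t : ℂ, aeval t P = F (addAll j B) (Function.update (fun i => (y i : ℂ)) j t)) ∧
      (∀ t : ℝ, P.eval t = (F (addAll j B) (Function.update (fun i => (y i : ℂ)) j t)).re) ∧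
      P.coeff r = (F B fun i => y i).re ∧
      (∀ t : ℝ, topPolar r P t =
        (Paving.sumAt 1 j F B (Function.update (fun i => (y i : ℂ)) j t)).re) ∧
      ∀ t : ℝ, (derivative P).eval t =
        (∑ k, F (addExcept j k B) (Function.update (fun i => (y i : ℂ)) j t)).re := by
  obtain ⟨f, hdeg, heval, hlead, hpol, hder⟩ := hP B hB fun i => (y i : ℂ)
  obtain ⟨P, rfl⟩ := exists_map_ofReal (f := f) (fun x => by
    rw [heval, ← ofReal_update]; exact hreg.im_eq_zero _ _)
  have hev : ∀ (R : ℝ[X]) (t : ℝ), (R.map (algebraMap ℝ ℂ)).eval (t : ℂ) = ((R.eval t : ℝ) : ℂ) :=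
    fun R t => eval_map_apply (algebraMap ℝ ℂ) t
  refine ⟨P, by simpa using hdeg, fun t => ?_, fun t => ?_, ?_, fun t => ?_, fun t => ?_⟩
  · rw [← heval, eval_map_algebraMap]
  · rw [← heval, hev, Complex.ofReal_re]
  · rw [← hlead, coeff_map]; rfl
  · rw [← hpol]
    simp only [topPolar, coeff_map, Complex.coe_algebraMap]
    norm_cast
  · rw [← hder, derivative_map, hev, Complex.ofReal_re]

/-- `F` is positive above `x`, with logarithmic derivatives at most `φ` in the directions of `W`. -/
def Barrier (F : Family ι r) (W : Finset ι) (x : ι → ℝ) (φ : ℝ) : Prop :=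
  ∀ T ⊆ W, ∀ y : ι → ℝ, (∀ i, x i ≤ y i) → 0 < (F (fun _ => T) fun i => y i).re ∧
    ∀ i ∈ T, (∑ k, F (Function.update (fun _ => T) k (T.erase i)) fun i => y i).re ≤
      φ * (F (fun _ => T) fun i => y i).re

/-- Up to the factor `|g(t)|²` this is the imaginary part of `g'/g = ∑ 1/(t - w)`. Each term
contributes nonpositively, since `t` is real and the roots `w` lie in the closed lower half plane.
-/
lemma im_derivative_mul_conj_nonpos {g : ℂ[X]} (hg : ∀ w : ℂ, 0 < w.im → g.eval w ≠ 0) (t : ℝ)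
    (ht : g.eval (t : ℂ) ≠ 0) :
    ((derivative g).eval (t : ℂ) * conj (g.eval (t : ℂ))).im ≤ 0 := by
  have h1 := (IsAlgClosed.splits g).eval_derivative_div_eval_of_ne_zero ht
  have h2 : (derivative g).eval (t : ℂ) * conj (g.eval (t : ℂ)) =
      ((‖g.eval (t : ℂ)‖ ^ 2 : ℝ) : ℂ) * (g.roots.map fun z => 1 / ((t : ℂ) - z)).sum := by
    rw [← h1, Complex.ofReal_pow, ← Complex.mul_conj']
    field_simp
  rw [h2, Complex.im_ofReal_mul]
  refine mul_nonpos_of_nonneg_of_nonpos (by positivity) ?_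
  have h3 : ∀ s : Multiset ℂ, (∀ w ∈ s, w.im ≤ 0) →
      ((s.map fun z => 1 / ((t : ℂ) - z)).sum).im ≤ 0 := by
    intro s
    induction s using Multiset.induction_on with
    | empty => simp
    | cons w s ih =>
      intro hs
      have h4 := ih fun v hv => hs v (Multiset.mem_cons_of_mem hv)
      have h5 := hs w (Multiset.mem_cons_self w s)
      rw [Multiset.map_cons, Multiset.sum_cons, Complex.add_im, one_div, Complex.inv_im,
        Complex.sub_im, Complex.ofReal_im]
      have : -(0 - w.im) / Complex.normSq (t - w) ≤ 0 :=
        div_nonpos_of_nonpos_of_nonneg (by linarith) (Complex.normSq_nonneg _)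
      linarith
  refine h3 _ fun w hw => ?_
  by_contra hpos
  exact hg w (not_le.mp hpos) (mem_roots'.mp hw).2

/-- Regard `F` with `j` in every set as a polynomial `P` in the `j`-th variable, and its derivative
in direction `i` as a polynomial `Q`. Distributing `j` replaces both by their polars, so
`topPolar_barrier` shows that the ratio at the lowered point is at most the old ratio `Q/P`, hence
at most `φ`. -/
lemma Barrier.sumAt_one {F : Family ι r} {L : List ι} (hr : 0 < r) (hF : Stable F L)
    (hreg : Regular F) {W : Finset ι} (hP : ∀ i ∈ W, Polarizes F i) (hWL : ∀ i ∈ W, i ∉ L)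
    {x : ι → ℝ} {φ : ℝ} (hφ : 0 < φ) (hb : Barrier F W x φ) {j : ι} (hj : j ∈ W) :
    Barrier (sumAt 1 j F) (W.erase j)
      (Function.update x j (x j - ((r : ℝ) - 1) ^ 2 / (r * φ))) φ := by
  intro T hT y hy
  set Δ := ((r : ℝ) - 1) ^ 2 / (r * φ) with hΔ
  have hjT : j ∉ T := fun h => Finset.notMem_erase j W (hT h)
  have hTW : T ⊆ W := hT.trans (Finset.erase_subset _ _)
  have hjTW : insert j T ⊆ W := Finset.insert_subset hj hTW
  set x₀ := y j + Δ with hx₀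
  set y' := Function.update y j x₀ with hy'
  have hxy : ∀ t, x₀ ≤ t → ∀ i, x i ≤ Function.update y j t i := by
    intro t ht i
    have := hy i
    by_cases h : i = j
    · subst h
      simp only [Function.update_self] at this ⊢
      linarith
    · simpa [h] using this
  have hup : ∀ t : ℂ, Function.update (fun i => (y' i : ℂ)) j t =
      Function.update (fun i => (y i : ℂ)) j t := by
    intro t
    rw [hy', ofReal_update, Function.update_idem]
  have hyj : Function.update (fun i => (y i : ℂ)) j ((y j : ℝ) : ℂ) = fun i => (y i : ℂ) :=
    Function.update_eq_self _ _
  have hy'up : Function.update (fun i => (y i : ℂ)) j ((x₀ : ℝ) : ℂ) = fun i => (y' i : ℂ) := by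
    rw [hy', ofReal_update]
  have hL : ∀ S ⊆ W, ∀ l ∈ L, ∀ k : Fin r, l ∉ (fun _ : Fin r => S) k :=
    fun S hS l hl _ h => hWL l (hS h) hl
  obtain ⟨P, hPdeg, hPc, hPeval, hPlead, hPpol, hPder⟩ :=
    (hP j hj).exists_real hreg (B := fun _ : Fin r => T) (fun _ => hjT) y'
  simp only [hup] at hPc hPeval hPpol hPder
  have hPpos : ∀ t, x₀ ≤ t → 0 < P.eval t := by
    intro t ht
    rw [hPeval, ← ofReal_update]
    exact (hb _ hjTW _ (hxy t ht)).1
  have hPH : ∀ z : ℂ, 0 < z.im → aeval z P ≠ 0 := by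
    intro z hz
    rw [hPc]
    refine hF.ne_zero_of_im_nonneg hreg (hP j hj) (hWL j hj) (hL T hTW) (fun _ => hjT) ?_
      (by simpa using hz) (a := (x₀ : ℂ)) ?_
    · intro l
      by_cases h : l = j
      · subst h; simpa using hz.le
      · simp [h]
    · rw [Function.update_idem]
      intro h
      have := hPpos x₀ le_rfl
      rw [hPeval, h] at this
      exact lt_irrefl _ this
  have hPleadpos : 0 < P.coeff r := by
    rw [hPlead]; exact (hb T hTW y' (hxy x₀ le_rfl)).1
  have hPφ : (derivative P).eval x₀ ≤ φ * P.eval x₀ := by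
    rw [hPder, hPeval, hy'up]
    have := (hb _ hjTW y' (hxy x₀ le_rfl)).2 j (Finset.mem_insert_self j T)
    rwa [Finset.erase_insert hjT] at this
  have hx₀Δ : x₀ - Δ = y j := by rw [hx₀]; ring
  have hsplit := splits_of_aeval_ne_zero hPH
  have hpolP : topPolar r P (x₀ - Δ) = (sumAt 1 j F (fun _ => T) fun i => (y i : ℂ)).re := by
    rw [hx₀Δ, hPpol, hyj]
  refine ⟨?_, fun i hi => ?_⟩
  · have h0 : ∀ z : ℂ, 0 < z.im → (aeval z (0 : ℝ[X]) * conj (aeval z P)).im ≤ 0 := by simp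
    have := (topPolar_barrier hr hsplit hPdeg hPleadpos (Q := 0) (by simp) h0 hφ hPpos hPφ).1
    rwa [hpolP] at this
  · have hij : i ≠ j := by rintro rfl; exact hjT hi
    have hiW := hTW hi
    let B : Fin r → Fin r → Finset ι := fun k => Function.update (fun _ => T) k (T.erase i)
    have hBj : ∀ k l, j ∉ B k l := by
      intro k l
      by_cases h : l = k
      · subst h; simp [B, hjT]
      · simp [B, h, hjT]
    have hBadd : ∀ k, addAll j (B k) =
        Function.update (fun _ => insert j T) k ((insert j T).erase i) := by
      intro k
      funext l
      by_cases h : l = k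
      · subst h; simp [B, addAll, Finset.erase_insert_of_ne hij.symm]
      · simp [B, addAll, h]
    choose q hqdeg hqc hqeval hqlead hqpol hqder using
      fun k => (hP j hj).exists_real hreg (hBj k) y'
    simp only [hup] at hqc hqeval hqpol hqder
    set Q := ∑ k, q k with hQ
    have hQdeg : Q.natDegree ≤ r := natDegree_sum_le_of_forall_le _ _ fun k _ => hqdeg k
    have hQeval : Q.eval x₀ ≤ φ * P.eval x₀ := by
      rw [hQ, eval_finsetSum, hPeval]
      simp only [hqeval, hBadd, hy'up]
      rw [← Complex.re_sum]
      exact (hb _ hjTW y' (hxy x₀ le_rfl)).2 i (Finset.mem_insert_of_mem hi)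
    have hQpol : topPolar r Q (x₀ - Δ) = (∑ k, sumAt 1 j F (B k) fun i => (y i : ℂ)).re := by
      rw [hQ, topPolar_sum, hx₀Δ]
      simp only [hqpol, hyj]
      rw [← Complex.re_sum]
    -- Fix the `j`-th variable at `z` and let the `i`-th vary: `P(z)` and `Q(z)` become the values
    -- at the real point `y i` of a polynomial `g` and its derivative. Stability up to the boundary
    -- puts the roots of `g` in the closed lower half plane.
    have hQP : ∀ z : ℂ, 0 < z.im → (aeval z Q * conj (aeval z P)).im ≤ 0 := by
      intro z hz
      set u := Function.update (fun i => (y i : ℂ)) j z with hu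
      set T' := T.erase i with hT'
      have hTT' : insert i T' = T := Finset.insert_erase hi
      have hiT' : i ∉ insert j T' := by
        rw [Finset.mem_insert, not_or]; exact ⟨hij, Finset.notMem_erase i T⟩
      have hT'W : insert j T' ⊆ W :=
        Finset.insert_subset hj ((Finset.erase_subset _ _).trans hTW)
      obtain ⟨g, -, hgeval, -, -, hgder⟩ :=
        hP i hiW (fun _ => insert j T') (fun _ => hiT') u
      have hui : u i = (y i : ℂ) := by simp [hu, hij]
      have huu : Function.update u i (y i : ℂ) = u := by rw [← hui, Function.update_eq_self]
      have hPg : aeval z P = g.eval (y i : ℂ) := by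
        rw [hPc, hgeval, huu]
        congr 1
        funext _
        simp only [addAll]
        rw [Finset.insert_comm, hTT']
      have hQg : aeval z Q = (derivative g).eval (y i : ℂ) := by
        rw [hQ, map_sum, hgder, huu]
        refine Finset.sum_congr rfl fun k _ => ?_
        rw [hqc]
        congr 1
        funext l
        by_cases h : l = k
        · subst h; simp [B, addAll, addExcept, hT']
        · simp only [B, addAll, addExcept, ne_eq, h, not_false_eq_true, Function.update_of_ne]
          rw [Finset.insert_comm, hTT']
      rw [hPg, hQg]
      refine im_derivative_mul_conj_nonpos (fun w hw => ?_) (y i) (by rw [← hPg]; exact hPH z hz)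
      rw [hgeval]
      refine hF.ne_zero_of_im_nonneg hreg (hP i hiW) (hWL i hiW) (hL _ hT'W) (fun _ => hiT') ?_
        (by simpa using hw) (a := (y i : ℂ)) ?_
      · intro l
        by_cases h : l = i
        · subst h; simpa using hw.le
        · by_cases h' : l = j
          · subst h'; simpa [h, hu] using hz.le
          · simp [h, h', hu]
      · rw [Function.update_idem, ← hgeval, ← hPg]
        exact hPH z hz
    have hfin := (topPolar_barrier hr hsplit hPdeg hPleadpos hQdeg hQP hφ hPpos hPφ)
    rw [hpolP, hQpol] at hfin
    have hPx := hPpos x₀ le_rfl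
    refine le_of_mul_le_mul_right (hfin.2.trans ?_) hPx
    calc _ ≤ φ * P.eval x₀ * (sumAt 1 j F (fun _ => T) fun i => (y i : ℂ)).re :=
          mul_le_mul_of_nonneg_right hQeval hfin.1.le
      _ = _ := by ring

lemma Barrier.distribute {F : Family ι r} (hr : 0 < r) (hF : Stable F []) (hreg : Regular F)
    (hP : ∀ i, Polarizes F i) {t φ : ℝ} (hφ : 0 < φ) (hb : Barrier F Finset.univ (fun _ => t) φ)
    (V : List ι) (hV : V.Nodup) :
    Barrier (distribute V F) (Finset.univ \ V.toFinset)
      (fun i => if i ∈ V then t - ((r : ℝ) - 1) ^ 2 / (r * φ) else t) φ := by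
  induction V with
  | nil => simpa using hb
  | cons j V ih =>
    rw [List.nodup_cons] at hV
    have hst : Stable (Paving.distribute V F) V := by
      have := hF.distribute hr (V := V) (fun i _ => hP i) (by simpa using hV.2)
      rwa [List.append_nil] at this
    have hW : ∀ i ∈ Finset.univ \ V.toFinset, i ∉ V := fun i hi => by simpa using hi
    have h := (ih hV.2).sumAt_one hr hst (hreg.distribute V)
      (fun i hi => (hP i).distribute (hW i hi)) hW hφ (j := j) (by simpa using hV.1)
    have e1 : Finset.univ \ (j :: V).toFinset = (Finset.univ \ V.toFinset).erase j := by
      ext i; simp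
    rw [e1, distribute_cons]
    convert h using 1
    funext i
    by_cases hi : i = j
    · subst hi; simp [hV.1]
    · simp [hi]

end Barrier

/-! ### Finite positive contractions with diagonal `1/2`. -/

section FinitePaving

variable {ι : Type*} [Fintype ι] [DecidableEq ι] {r : ℕ}

lemma herm_add_smul_single {M : Matrix ι ι ℂ} (hM : M.IsHermitian) (v : ι → ℂ) (j : ι) (μ : ℂ) :
    herm M (v + μ • Pi.single j 1) =
      herm M v + conj μ * M.mulVec v j + μ * conj (M.mulVec v j) + μ * conj μ * M j j := by
  have h1 : star v ⬝ᵥ M.mulVec (Pi.single j 1) = conj (M.mulVec v j) := by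
    have h2 := Matrix.star_dotProduct (M.mulVec (Pi.single j 1)) v
    rw [← Matrix.star_dotProduct, Matrix.star_mulVec, hM.eq, ← Matrix.dotProduct_mulVec] at h2
    have h3 : star (Pi.single j (1 : ℂ) : ι → ℂ) = Pi.single j 1 := by
      rw [← Pi.single_star]; simp
    rw [Matrix.star_dotProduct, Matrix.star_mulVec, hM.eq, ← Matrix.dotProduct_mulVec, h3,
      single_one_dotProduct]
    rfl
  have h3 : star (Pi.single j (1 : ℂ) : ι → ℂ) = Pi.single j 1 := by
    rw [← Pi.single_star]; simp
  simp only [herm, Matrix.mulVec_add, Matrix.mulVec_smul, star_add, star_smul, add_dotProduct,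
    dotProduct_add, dotProduct_smul, smul_dotProduct, h1, h3, single_one_dotProduct, smul_eq_mul]
  simp only [Matrix.mulVec_single_one, Matrix.col_apply, RCLike.star_def]
  ring

/-- Cauchy–Schwarz for the form of `M`: it is evaluated at its minimum along `v + μ e_j`, reached at
`μ = -(M v)_j / M_jj`, hence the factor `-2`. -/
lemma sq_norm_mulVec_le {M : Matrix ι ι ℂ} (hM : M.IsHermitian)
    (h0 : ∀ v, 0 ≤ (herm M v).re) {j : ι} (hj : M j j = 1 / 2) (v : ι → ℂ) :
    2 * ‖M.mulVec v j‖ ^ 2 ≤ (herm M v).re := by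
  set w := M.mulVec v j with hw
  have h1 := h0 (v + (-2 * w) • Pi.single j 1)
  rw [herm_add_smul_single hM, ← hw, hj] at h1
  have h2 : herm M v + conj (-2 * w) * w + -2 * w * conj w + -2 * w * conj (-2 * w) * (1 / 2) =
      herm M v + ((-2 * ‖w‖ ^ 2 : ℝ) : ℂ) := by
    have h3 : w * conj w = (‖w‖ : ℂ) ^ 2 := Complex.mul_conj' w
    simp only [map_mul, map_neg, map_ofNat]
    push_cast
    rw [← h3]; ring
  rw [h2, Complex.add_re, Complex.ofReal_re] at h1
  linarith

lemma herm_one_sub (A : Matrix ι ι ℂ) (v : ι → ℂ) :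
    herm (1 - A) v = ((∑ i, ‖v i‖ ^ 2 : ℝ) : ℂ) - herm A v := by
  simp only [herm, Matrix.sub_mulVec, Matrix.one_mulVec, dotProduct_sub]
  congr 1
  simp only [dotProduct, Pi.star_apply, RCLike.star_def, Complex.ofReal_sum, Complex.ofReal_pow]
  exact Finset.sum_congr rfl fun i _ => Complex.conj_mul' (v i)

/-- A positive contraction with constant diagonal `1 / 2`. -/
structure HalfContraction (A : Matrix ι ι ℂ) : Prop where
  hermitian : A.IsHermitian
  nonneg : ∀ v, 0 ≤ (herm A v).re
  le_one : ∀ v, (herm A v).re ≤ ∑ i, ‖v i‖ ^ 2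
  diag : ∀ i, A i i = 1 / 2

/-- Write `(1+s) - A = sA + (1+s)(1-A)` and `v_j = (Av)_j + ((1-A)v)_j`. Both `A` and `1-A` are
positive with diagonal `1/2`, so each form dominates twice the square of its own `j`-th component;
the constant is the minimum of `2sp² + 2(1+s)q²` for `p + q = 1`. For the resolvent at `1+s` this
bounds the diagonal entries by `(1+2s)/(2s(1+s))`. -/
lemma HalfContraction.shift_le {A : Matrix ι ι ℂ} (hA : HalfContraction A) {s : ℝ} (hs : 0 < s)
    (v : ι → ℂ) (j : ι) :
    (herm A v).re + 2 * s * (1 + s) / (1 + 2 * s) * ‖v j‖ ^ 2 ≤ (1 + s) * ∑ i, ‖v i‖ ^ 2 := by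
  have hB : (1 - A).IsHermitian := Matrix.isHermitian_one.sub hA.hermitian
  have hBre : ∀ v, (herm (1 - A) v).re = ∑ i, ‖v i‖ ^ 2 - (herm A v).re := fun v => by
    rw [herm_one_sub, Complex.sub_re, Complex.ofReal_re]
  have h1 := sq_norm_mulVec_le hA.hermitian hA.nonneg (hA.diag j) v
  have h2 := sq_norm_mulVec_le hB (fun v => by rw [hBre]; linarith [hA.le_one v])
    (j := j) (by simp [hA.diag]; norm_num) v
  rw [hBre, Matrix.sub_mulVec, Matrix.one_mulVec, Pi.sub_apply] at h2
  set a := A.mulVec v j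
  set p := ‖a‖
  set q := ‖v j - a‖
  have h3 : ‖v j‖ ≤ p + q := by
    have := norm_add_le a (v j - a)
    simpa using this
  have h4 : ‖v j‖ ^ 2 ≤ (p + q) ^ 2 := pow_le_pow_left₀ (norm_nonneg _) h3 2
  have h5 : 2 * s * (1 + s) / (1 + 2 * s) * (p + q) ^ 2 ≤ s * (2 * p ^ 2) + (1 + s) * (2 * q ^ 2) := by
    rw [div_mul_eq_mul_div, div_le_iff₀ (by positivity)]
    nlinarith [sq_nonneg (s * p - (1 + s) * q)]
  have h6 : 2 * s * (1 + s) / (1 + 2 * s) * ‖v j‖ ^ 2 ≤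
      2 * s * (1 + s) / (1 + 2 * s) * (p + q) ^ 2 :=
    mul_le_mul_of_nonneg_left h4 (by positivity)
  nlinarith

lemma minorFamily_re (A : Matrix ι ι ℂ) (hA : A.IsHermitian) (B : Fin r → Finset ι) (y : ι → ℝ) :
    (minorFamily A r B fun i => y i).re = ∏ k, (principalMinor A (B k) fun i => y i).re := by
  have h : ∀ S, principalMinor A S (fun i => (y i : ℂ)) =
      (((principalMinor A S fun i => (y i : ℂ)).re : ℝ) : ℂ) := fun S => by
    refine (Complex.conj_eq_iff_re.mp ?_).symm
    rw [principalMinor_conj A hA]; simp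
  rw [minorFamily, Finset.prod_congr rfl fun k _ => h (B k), ← Complex.ofReal_prod,
    Complex.ofReal_re]

/-- By `shift_le`, lowering one coordinate by anything less than `δ = 2s(1+s)/(1+2s)` keeps the form
definite and so the minors positive. Affinity in that coordinate then bounds each logarithmic
derivative by `1/δ`, and the `r` equal factors add up. -/
lemma HalfContraction.barrier {A : Matrix ι ι ℂ} (hA : HalfContraction A) (hr : 0 < r) {s : ℝ}
    (hs : 0 < s) :
    Barrier (minorFamily A r) Finset.univ (fun _ => 1 + s)
      (r * ((1 + 2 * s) / (2 * s * (1 + s)))) := by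
  intro T _ y hy
  have hgood : ∀ (j : ι) (τ : ℝ), 0 < τ → ∀ v : ι → ℂ, v ≠ 0 → (herm A v).re <
      ∑ i, Function.update y j (y j - 2 * s * (1 + s) / (1 + 2 * s) + τ) i * ‖v i‖ ^ 2 := by
    intro j τ hτ v hv
    have h1 := hA.shift_le hs v j
    have h2 : ∑ i, Function.update y j (y j - 2 * s * (1 + s) / (1 + 2 * s) + τ) i * ‖v i‖ ^ 2 =
        ∑ i, y i * ‖v i‖ ^ 2 + (τ - 2 * s * (1 + s) / (1 + 2 * s)) * ‖v j‖ ^ 2 := by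
      rw [← Finset.add_sum_erase _ _ (Finset.mem_univ j),
        ← Finset.add_sum_erase _ (fun i => y i * ‖v i‖ ^ 2) (Finset.mem_univ j),
        Finset.sum_congr rfl fun i hi => by
          rw [Function.update_of_ne (Finset.ne_of_mem_erase hi)], Function.update_self]
      ring
    have h3 : (1 + s) * ∑ i, ‖v i‖ ^ 2 ≤ ∑ i, y i * ‖v i‖ ^ 2 := by
      rw [Finset.mul_sum]
      exact Finset.sum_le_sum fun i _ => mul_le_mul_of_nonneg_right (hy i) (by positivity)
    rw [h2]
    by_cases hvj : v j = 0
    · simp only [hvj, norm_zero, ne_eq, OfNat.ofNat_ne_zero, not_false_eq_true, zero_pow,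
        mul_zero, add_zero] at h1 ⊢
      have hpos : 0 < ∑ i, ‖v i‖ ^ 2 := by
        obtain ⟨i, hi⟩ := Function.ne_iff.mp hv
        exact Finset.sum_pos' (fun i _ => by positivity)
          ⟨i, Finset.mem_univ i, pow_pos (norm_pos_iff.mpr hi) 2⟩
      have := hA.le_one v
      nlinarith
    · have : 0 < τ * ‖v j‖ ^ 2 := mul_pos hτ (pow_pos (norm_pos_iff.mpr hvj) 2)
      nlinarith
  have hgood' : ∀ v : ι → ℂ, v ≠ 0 → (herm A v).re < ∑ i, y i * ‖v i‖ ^ 2 := by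
    intro v hv
    obtain ⟨j, -⟩ := Function.ne_iff.mp hv
    have := hgood j (2 * s * (1 + s) / (1 + 2 * s)) (by positivity) v hv
    simpa using this
  have hpos : ∀ S, 0 < (principalMinor A S fun i => (y i : ℂ)).re := fun S =>
    principalMinor_re_pos A hA.hermitian S y hgood'
  refine ⟨?_, fun j hj => ?_⟩
  · rw [minorFamily_re A hA.hermitian]
    exact Finset.prod_pos fun k _ => hpos T
  · set δ := 2 * s * (1 + s) / (1 + 2 * s) with hδ
    have hδ0 : 0 < δ := by positivity
    set d := (principalMinor A T fun i => (y i : ℂ)).re with hd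
    set d' := (principalMinor A (T.erase j) fun i => (y i : ℂ)).re with hd'
    have hd0 : 0 < d := hpos T
    have hd'0 : 0 < d' := hpos _
    have hins : ∀ t : ℝ, (principalMinor A T
        (fun i => (Function.update y j t i : ℝ))).re = d + (t - y j) * d' := by
      intro t
      have hjT := Finset.notMem_erase j T
      have h1 := principalMinor_insert A hjT (fun i => (y i : ℂ)) t
      have h2 := principalMinor_insert A hjT (fun i => (y i : ℂ)) (y j)
      rw [Finset.insert_erase hj] at h1 h2
      rw [Function.update_eq_self] at h2
      rw [ofReal_update, h1, hd, h2]
      simp only [Complex.add_re, Complex.re_ofReal_mul, ← hd']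
      ring
    have hle : δ * d' ≤ d := by
      by_contra hlt
      rw [not_le] at hlt
      -- With this `τ` the coordinate is lowered by exactly `d/d'`, where the affine function
      -- vanishes.
      have hτ : 0 < δ - d / d' := by
        rw [sub_pos, div_lt_iff₀ hd'0]; exact hlt
      have := principalMinor_re_pos A hA.hermitian T _ (hgood j _ hτ)
      rw [hins] at this
      have h2 : d + (y j - δ + (δ - d / d') - y j) * d' = 0 := by field_simp; ring
      rw [h2] at this
      exact lt_irrefl _ this
    have hsum : (∑ k : Fin r, minorFamily A r (Function.update (fun _ => T) k (T.erase j))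
        fun i => (y i : ℂ)).re = r * (d' * d ^ (r - 1)) := by
      rw [Complex.re_sum]
      have : ∀ k : Fin r, (minorFamily A r (Function.update (fun _ => T) k (T.erase j))
          fun i => (y i : ℂ)).re = d' * d ^ (r - 1) := by
        intro k
        rw [minorFamily_re A hA.hermitian, ← Finset.mul_prod_erase _ _ (Finset.mem_univ k),
          Function.update_self, Finset.prod_congr rfl fun l hl => by
            rw [Function.update_of_ne (Finset.ne_of_mem_erase hl)]]
        simp [Finset.card_erase_of_mem, hd, hd']
      simp [this]
    have hval : (minorFamily A r (fun _ => T) fun i => (y i : ℂ)).re = d * d ^ (r - 1) := by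
      rw [minorFamily_re A hA.hermitian]
      simp only [Finset.prod_const, Finset.card_univ, Fintype.card_fin, ← hd]
      rw [← pow_succ', Nat.sub_add_cancel hr]
    rw [hsum, hval, mul_assoc]
    refine mul_le_mul_of_nonneg_left ?_ (by positivity)
    have h3 : d' ≤ (1 + 2 * s) / (2 * s * (1 + s)) * d := by
      have : (1 + 2 * s) / (2 * s * (1 + s)) = δ⁻¹ := by rw [hδ, inv_div]
      rw [this, inv_mul_eq_div, le_div_iff₀ hδ0]; linarith
    calc d' * d ^ (r - 1) ≤ (1 + 2 * s) / (2 * s * (1 + s)) * d * d ^ (r - 1) :=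
          mul_le_mul_of_nonneg_right h3 (by positivity)
      _ = _ := by ring

lemma distribute_minorFamily_pos {A : Matrix ι ι ℂ} (hA : A.IsHermitian) (hr : 0 < r) {y : ι → ℝ}
    (hy : ∀ v : ι → ℂ, v ≠ 0 → (herm A v).re < ∑ i, y i * ‖v i‖ ^ 2) (V : List ι) :
    ∀ B : Fin r → Finset ι, 0 < (distribute V (minorFamily A r) B fun i => y i).re := by
  induction V with
  | nil =>
    intro B
    rw [distribute_nil, minorFamily_re A hA]
    exact Finset.prod_pos fun k _ => principalMinor_re_pos A hA (B k) y hy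
  | cons j V ih =>
    intro B
    simp only [distribute_cons, sumAt, Pi.one_apply, one_mul, Complex.re_sum]
    exact Finset.sum_pos (fun k _ => ih _) ⟨⟨0, hr⟩, Finset.mem_univ _⟩

/-- Interlacing: the elements of `V` can be distributed one at a time without creating roots
above `ρ`. -/
lemma exists_distribution {A : Matrix ι ι ℂ} (hA : A.IsHermitian) (hr : 0 < r)
    (hA1 : ∀ v, (herm A v).re ≤ ∑ i, ‖v i‖ ^ 2) {ρ : ℝ} (V : List ι) (hV : V.Nodup) :
    ∀ B : Fin r → Finset ι, (∀ i ∈ V, ∀ k, i ∉ B k) →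
      (∀ x : ℝ, ρ < x → distribute V (minorFamily A r) B (fun _ => x) ≠ 0) →
      ∃ B' : Fin r → Finset ι, (∀ k, B k ⊆ B' k) ∧ (∀ i ∈ V, ∃ k, i ∈ B' k) ∧
        ∀ x : ℝ, ρ < x → minorFamily A r B' (fun _ => x) ≠ 0 := by
  induction V with
  | nil => exact fun B _ h => ⟨B, fun _ => subset_rfl, by simp, h⟩
  | cons j V ih =>
    intro B hB h
    rw [List.nodup_cons] at hV
    have hP := polarizes_minorFamily A hr
    have hreg := (regular_minorFamily (r := r) hA).distribute V
    choose f hf using fun k => hreg.diagonal (addAt j k B)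
    -- The candidates are the `r` sets that could receive `j`, with the indices of `V` still summed
    -- over.
    obtain ⟨k, -, hk⟩ := exists_forall_eval_ne_zero (s := Finset.univ) f (ρ := ρ)
      (fun k z => by rw [hf, hf, hreg.conj_apply])
      (fun k => ⟨1, fun x hx => by
        rw [hf]
        refine distribute_minorFamily_pos hA hr (y := fun _ => x) (fun v hv => ?_) V _
        refine (hA1 v).trans_lt ?_
        rw [← Finset.mul_sum]
        have hpos : 0 < ∑ i, ‖v i‖ ^ 2 := by
          obtain ⟨i, hi⟩ := Function.ne_iff.mp hv
          exact Finset.sum_pos' (fun i _ => by positivity)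
            ⟨i, Finset.mem_univ i, pow_pos (norm_pos_iff.mpr hi) 2⟩
        nlinarith⟩)
      ⟨⟨0, hr⟩, Finset.mem_univ _⟩
      (fun c hc hc' z hz => by
        obtain ⟨k, -, hk⟩ := hc'
        -- Weighted stability is known for minors only, so the weighted sum over `j` is taken
        -- innermost and then commuted past the distribution of `V`.
        have hst := (stable_sumAt_minorFamily (r := r) hA hc ⟨k, hk⟩ j).distribute hr (V := V)
          (fun i hi => (hP i).sumAt (by rintro rfl; exact hV.1 hi) _)
          (by simpa [List.nodup_append] using
            ⟨hV.2, fun a ha (h : a = j) => hV.1 (h ▸ ha)⟩)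
        rw [← sumAt_distribute] at hst
        have := hst B (fun i hi k => hB i (by
          rw [List.mem_append, List.mem_singleton] at hi
          rw [List.mem_cons]; exact hi.symm) k) (fun _ => z) (fun _ => hz)
        simpa [sumAt, hf] using this)
      (fun x hx => by
        have := h x hx
        simpa [sumAt, hf] using this)
    obtain ⟨B', h1, h2, h3⟩ := ih hV.2 (addAt j k B)
      (fun i hi => notMem_addAt (by rintro rfl; exact hV.1 hi) k (hB i (by simp [hi])))
      (fun x hx => by rw [← hf]; exact hk x hx)
    refine ⟨B', fun l => ?_, fun i hi => ?_, h3⟩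
    · refine subset_trans ?_ (h1 l)
      by_cases e : l = k
      · subst e; simp [addAt]
      · simp [addAt, e]
    · rcases List.mem_cons.mp hi with rfl | hi
      · exact ⟨k, h1 k (by simp [addAt])⟩
      · exact h2 i hi

open scoped ComplexOrder in
-- A negative eigenvalue `μ` of `ρ - M`, with `M` the block of `A` on `S` extended by zero, makes
-- the minor vanish at `ρ - μ > ρ`. Since `ρ ≥ 0`, this number is nonzero, so the eigenvector is
-- supported in `S`.
lemma herm_re_le_of_principalMinor_ne_zero {A : Matrix ι ι ℂ} (hA : A.IsHermitian) {S : Finset ι}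
    {ρ : ℝ} (hρ : 0 ≤ ρ) (h : ∀ x : ℝ, ρ < x → principalMinor A S (fun _ => x) ≠ 0) (v : ι → ℂ)
    (hv : ∀ i ∉ S, v i = 0) : (herm A v).re ≤ ρ * ∑ i, ‖v i‖ ^ 2 := by
  set M : Matrix ι ι ℂ := Matrix.of fun i j => if i ∈ S ∧ j ∈ S then A i j else 0 with hM
  have hMh : M.IsHermitian := by
    ext i j
    have := hA.apply i j
    simp only [hM, Matrix.conjTranspose_apply, Matrix.of_apply]
    by_cases hi : i ∈ S <;> by_cases hj : j ∈ S <;> simp [hi, hj] at this ⊢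
    exact this
  have hNh : ((ρ : ℂ) • (1 : Matrix ι ι ℂ) - M).IsHermitian := by
    refine Matrix.IsHermitian.sub ?_ hMh
    ext i j
    by_cases e : i = j
    · subst e; simp
    · simp [Matrix.one_apply_ne e, Matrix.one_apply_ne (fun h => e h.symm : j ≠ i)]
  have hpsd : ((ρ : ℂ) • (1 : Matrix ι ι ℂ) - M).PosSemidef := by
    rw [hNh.posSemidef_iff_eigenvalues_nonneg]
    intro k
    by_contra hneg
    set μ := hNh.eigenvalues k with hμ
    have hμ0 : μ < 0 := not_le.mp hneg
    set w : ι → ℂ := (hNh.eigenvectorBasis k).ofLp with hw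
    have hw0 : w ≠ 0 := by
      intro h0
      have h1 : hNh.eigenvectorBasis k = 0 := by
        ext i; exact congrFun h0 i
      exact hNh.eigenvectorBasis.orthonormal.ne_zero k h1
    have hev := hNh.mulVec_eigenvectorBasis k
    rw [← hw, ← hμ, Matrix.sub_mulVec, Matrix.smul_mulVec, Matrix.one_mulVec] at hev
    have hMw : ∀ i, M.mulVec w i = ((ρ - μ : ℝ) : ℂ) * w i := by
      intro i
      have := congrFun hev i
      simp only [Pi.sub_apply, Pi.smul_apply, smul_eq_mul, Complex.real_smul] at this
      push_cast
      linear_combination -this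
    have hw_out : ∀ i ∉ S, w i = 0 := by
      intro i hi
      have h1 := hMw i
      have h2 : M.mulVec w i = 0 := by
        simp [Matrix.mulVec, dotProduct, hM, hi]
      rw [h2] at h1
      refine (mul_eq_zero.mp h1.symm).resolve_left ?_
      have : (ρ - μ : ℝ) ≠ 0 := by linarith
      exact_mod_cast this
    refine h (ρ - μ) (by linarith) (Matrix.exists_mulVec_eq_zero_iff.mp ⟨w, hw0, ?_⟩)
    ext i
    by_cases hi : i ∈ S
    · have h1 : (principalMat A S fun _ => ((ρ - μ : ℝ) : ℂ)).mulVec w i =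
          ((ρ - μ : ℝ) : ℂ) * w i - M.mulVec w i := by
        rw [← Matrix.mulVec_diagonal (fun _ => ((ρ - μ : ℝ) : ℂ)) w i, ← Pi.sub_apply,
          ← Matrix.sub_mulVec]
        simp only [Matrix.mulVec, dotProduct, principalMat, Matrix.of_apply, hM]
        refine Finset.sum_congr rfl fun k _ => ?_
        by_cases hk : k ∈ S
        · simp [hi, hk]
        · simp [hw_out k hk]
      rw [h1, hMw, sub_self]; rfl
    · simp [Matrix.mulVec, dotProduct, principalMat, hi, Matrix.one_apply, hw_out i hi]
  have h1 := hpsd.dotProduct_mulVec_nonneg v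
  rw [Matrix.sub_mulVec, dotProduct_sub, Matrix.smul_mulVec, Matrix.one_mulVec, dotProduct_smul]
    at h1
  have h2 : star v ⬝ᵥ M.mulVec v = herm A v := by
    simp only [herm, dotProduct]
    refine Finset.sum_congr rfl fun i _ => ?_
    by_cases hi : i ∈ S
    · congr 1
      simp only [Matrix.mulVec, dotProduct, hM, Matrix.of_apply]
      refine Finset.sum_congr rfl fun k _ => ?_
      by_cases hk : k ∈ S
      · simp [hi, hk]
      · simp [hv k hk]
    · simp [hv i hi]
  have h3 : star v ⬝ᵥ v = ((∑ i, ‖v i‖ ^ 2 : ℝ) : ℂ) := by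
    simp only [dotProduct, Pi.star_apply, RCLike.star_def, Complex.ofReal_sum, Complex.ofReal_pow]
    exact Finset.sum_congr rfl fun i _ => Complex.conj_mul' (v i)
  rw [h2, h3, smul_eq_mul] at h1
  have h4 := (Complex.le_def.mp h1).1
  rw [Complex.sub_re, Complex.re_ofReal_mul, Complex.ofReal_re, Complex.zero_re] at h4
  linarith

/-- Here `u = √r` and `s = (u-1)/2`, so the shift is `(u²-1)³/(2u⁵) ≥ u/2 - 3/(2u)`. Subtracted from
`1+s = (u+1)/2` it leaves at most `1/2 + 3/(2u)`, which is where `u ≥ 6/ε`, that is `r ≥ 36/ε²`,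
comes from. -/
lemma barrier_bound {ε u : ℝ} (hε : 0 < ε) (hu : 1 < u) (hεu : 6 / ε ≤ u) :
    1 + (u - 1) / 2 - (u ^ 2 - 1) ^ 2 / (u ^ 2 * (u ^ 2 * ((1 + 2 * ((u - 1) / 2)) /
      (2 * ((u - 1) / 2) * (1 + (u - 1) / 2))))) ≤ (1 + ε) / 2 := by
  have hu0 : 0 < u := by linarith
  have h1 : (1 + 2 * ((u - 1) / 2)) / (2 * ((u - 1) / 2) * (1 + (u - 1) / 2)) =
      2 * u / (u ^ 2 - 1) := by
    have : u - 1 ≠ 0 := by linarith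
    have : u + 1 ≠ 0 := by linarith
    have h2 : u ^ 2 - 1 ≠ 0 := by nlinarith
    have h3 : 2 * ((u - 1) / 2) * (1 + (u - 1) / 2) = (u ^ 2 - 1) / 2 := by ring
    have h4 : 1 + 2 * ((u - 1) / 2) = u := by ring
    rw [h3, h4]; field_simp
  rw [h1]
  have hu2 : 0 < u ^ 2 - 1 := by nlinarith
  have h5 : (u ^ 2 - 1) ^ 2 / (u ^ 2 * (u ^ 2 * (2 * u / (u ^ 2 - 1)))) =
      (u ^ 2 - 1) ^ 3 / (2 * u ^ 5) := by
    field_simp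
  rw [h5]
  have h6 : 6 ≤ ε * u := by rw [div_le_iff₀ hε] at hεu; linarith
  have h7 : u ^ 6 - 3 * u ^ 4 ≤ (u ^ 2 - 1) ^ 3 := by nlinarith [sq_nonneg u]
  have h8 : (u ^ 6 - 3 * u ^ 4) / (2 * u ^ 5) ≤ (u ^ 2 - 1) ^ 3 / (2 * u ^ 5) := by gcongr
  have h9 : (u ^ 6 - 3 * u ^ 4) / (2 * u ^ 5) = u / 2 - 3 / (2 * u) := by field_simp
  have h10 : 3 / (2 * u) ≤ ε / 2 := by
    rw [div_le_div_iff₀ (by positivity) (by norm_num)]; nlinarith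
  linarith

/-- Paving of finite positive contractions with diagonal `1 / 2`. -/
theorem HalfContraction.exists_coloring {A : Matrix ι ι ℂ} (hA : HalfContraction A) {ε : ℝ}
    (hε : 0 < ε) (hε1 : ε < 1) (hr : 36 / ε ^ 2 ≤ r) :
    ∃ χ : ι → Fin r, ∀ k, ∀ v : ι → ℂ, (∀ i, χ i ≠ k → v i = 0) →
      (herm A v).re ≤ (1 + ε) / 2 * ∑ i, ‖v i‖ ^ 2 := by
  have hr36 : (36 : ℝ) < r := by
    refine lt_of_lt_of_le ?_ hr
    rw [lt_div_iff₀ (by positivity)]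
    nlinarith
  have hr0 : 0 < r := by
    have : (0 : ℝ) < r := by linarith
    exact_mod_cast this
  set u := Real.sqrt r with hu
  have hu2 : u ^ 2 = r := Real.sq_sqrt (by positivity)
  have hu0 : 0 ≤ u := Real.sqrt_nonneg _
  have hu1 : 1 < u := by nlinarith
  have hεu : 6 / ε ≤ u := by
    rw [hu]
    refine Real.le_sqrt_of_sq_le ?_
    rw [div_pow]; norm_num; exact hr
  set s := (u - 1) / 2 with hs
  have hs0 : 0 < s := by rw [hs]; linarith
  set φ := (r : ℝ) * ((1 + 2 * s) / (2 * s * (1 + s))) with hφ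
  have hφ0 : 0 < φ := by
    have : (0 : ℝ) < r := by exact_mod_cast hr0
    positivity
  have hbar := (hA.barrier hr0 hs0).distribute hr0 (stable_minorFamily hA.hermitian)
    (regular_minorFamily hA.hermitian) (polarizes_minorFamily A hr0) hφ0
    Finset.univ.toList (Finset.nodup_toList _)
  have hbound : 1 + s - ((r : ℝ) - 1) ^ 2 / (r * φ) ≤ (1 + ε) / 2 := by
    have := barrier_bound hε hu1 hεu
    rwa [← hs, hu2] at this
  -- All indices are distributed starting from empty sets, so the barrier is needed only at the
  -- empty tuple, where it says that the total sum is positive above the shifted point.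
  obtain ⟨B, -, hcov, hB⟩ := exists_distribution hA.hermitian hr0 hA.le_one (ρ := (1 + ε) / 2)
    Finset.univ.toList (Finset.nodup_toList _) (fun _ => ∅) (by simp) (fun x hx h0 => by
      have := (hbar ∅ (by simp) (fun _ => x) (fun i => by
        simp only [Finset.mem_toList, Finset.mem_univ, if_true]
        linarith)).1
      rw [h0] at this
      exact lt_irrefl _ this)
  choose χ hχ using fun i => hcov i (by simp)
  refine ⟨χ, fun k v hv => ?_⟩
  refine herm_re_le_of_principalMinor_ne_zero hA.hermitian (S := B k) (by linarith)
    (fun x hx => ?_) v (fun i hi => hv i ?_)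
  · exact Finset.prod_ne_zero_iff.mp (hB x hx) k (Finset.mem_univ k)
  · rintro rfl; exact hi (hχ i)

end FinitePaving

/-! ### Passage to operators on `ℓ²(I)`: compactness and reductions. -/

section Operators

variable {I : Type u}

lemma orthonormal_basisVec : Orthonormal ℂ (basisVec : I → ell2 I) := by
  classical
  rw [orthonormal_iff_ite]
  intro i j
  rw [basisVec, lp.inner_single_left, basisVec, lp.single_apply]
  by_cases h : i = j
  · subst h; simp
  · simp [h]

/-- The vector with coordinates `v` on the finite set `F`. -/
noncomputable def finVec (F : Finset I) (v : F → ℂ) : ell2 I := ∑ i : F, v i • basisVec (i : I)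

/-- The matrix of `T` on the coordinates in `F`. -/
noncomputable def finMat (T : ell2 I →L[ℂ] ell2 I) (F : Finset I) : Matrix F F ℂ :=
  Matrix.of fun i j => inner ℂ (basisVec (i : I)) (T (basisVec (j : I)))

lemma inner_finVec (T : ell2 I →L[ℂ] ell2 I) (F : Finset I) (v : F → ℂ) :
    inner ℂ (finVec F v) (T (finVec F v)) = herm (finMat T F) v := by
  simp only [finVec, map_sum, map_smul, sum_inner, inner_sum, inner_smul_left, inner_smul_right,
    herm, dotProduct, Matrix.mulVec, finMat, Matrix.of_apply, Pi.star_apply, RCLike.star_def,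
    Finset.mul_sum]
  rw [Finset.sum_comm]
  exact Finset.sum_congr rfl fun i _ => Finset.sum_congr rfl fun j _ => by ring

lemma norm_finVec_sq (F : Finset I) (v : F → ℂ) : ‖finVec F v‖ ^ 2 = ∑ i, ‖v i‖ ^ 2 := by
  have ho : Orthonormal ℂ fun i : F => (basisVec (i : I) : ell2 I) :=
    orthonormal_basisVec.comp _ Subtype.val_injective
  have h1 := ho.inner_sum v v Finset.univ
  have h2 : (((‖finVec F v‖ ^ 2 : ℝ)) : ℂ) = ((∑ i, ‖v i‖ ^ 2 : ℝ) : ℂ) := by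
    rw [Complex.ofReal_pow, ← Complex.coe_algebraMap, ← inner_self_eq_norm_sq_to_K (𝕜 := ℂ)]
    rw [finVec, h1, Complex.coe_algebraMap, Complex.ofReal_sum]
    exact Finset.sum_congr rfl fun i _ => by rw [Complex.ofReal_pow, Complex.conj_mul']
  exact_mod_cast h2

lemma halfContraction_finMat {T : ell2 I →L[ℂ] ell2 I} (hT : IsSelfAdjoint T)
    (h0 : ∀ x, 0 ≤ (inner ℂ x (T x)).re) (h1 : ∀ x, (inner ℂ x (T x)).re ≤ ‖x‖ ^ 2)
    (hd : ∀ i, diagEntry T i = 1 / 2) (F : Finset I) : HalfContraction (finMat T F) where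
  hermitian := by
    ext i j
    simp only [finMat, Matrix.conjTranspose_apply, Matrix.of_apply, RCLike.star_def]
    rw [inner_conj_symm]
    exact (ContinuousLinearMap.isSelfAdjoint_iff_isSymmetric.mp hT) _ _
  nonneg v := by rw [← inner_finVec]; exact h0 _
  le_one v := by rw [← inner_finVec, ← norm_finVec_sq]; exact h1 _
  diag i := hd i

/-- Paving of positive contractions with diagonal `1 / 2`, in terms of quadratic forms. -/
theorem exists_coloring {T : ell2 I →L[ℂ] ell2 I} (hT : IsSelfAdjoint T)
    (h0 : ∀ x, 0 ≤ (inner ℂ x (T x)).re) (h1 : ∀ x, (inner ℂ x (T x)).re ≤ ‖x‖ ^ 2)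
    (hd : ∀ i, diagEntry T i = 1 / 2) {ε : ℝ} (hε : 0 < ε) (hε1 : ε < 1) {r : ℕ}
    (hr : 36 / ε ^ 2 ≤ r) :
    ∃ χ : I → Fin r, ∀ k, ∀ x ∈ Submodule.span ℂ (basisVec '' {i | χ i = k}),
      (inner ℂ x (T x)).re ≤ (1 + ε) / 2 * ‖x‖ ^ 2 := by
  classical
  choose g hg using fun F : Finset I =>
    (halfContraction_finMat hT h0 h1 hd F).exists_coloring hε hε1 hr
  have hr0 : 0 < r := by
    have : (0 : ℝ) < r := lt_of_lt_of_le (by positivity) hr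
    exact_mod_cast this
  -- Compactness: on every finite set the global coloring agrees with the coloring of some larger
  -- finite set. The default color off that larger set plays no role.
  obtain ⟨χ, hχ⟩ := Finset.rado_selection (β := fun _ : I => Fin r)
    fun F i => if h : i ∈ F then g F ⟨i, h⟩ else ⟨0, hr0⟩
  refine ⟨χ, fun k x hx => ?_⟩
  obtain ⟨t, ht, c, rfl⟩ := (Submodule.mem_span_image_iff_exists_fun ℂ).mp hx
  obtain ⟨F, hsF, hF⟩ := hχ t
  let v : F → ℂ := fun i => if h : (i : I) ∈ t then c ⟨i, h⟩ else 0
  have hv : ∑ i, c i • basisVec (i : I) = finVec F v := by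
    let w : I → ell2 I := fun i => if h : i ∈ t then c ⟨i, h⟩ • basisVec i else 0
    have e1 : ∑ i, c i • basisVec (i : I) = ∑ i ∈ t, w i := by
      rw [← Finset.sum_coe_sort t w]
      exact Finset.sum_congr rfl fun i _ => by simp [w]
    have e2 : finVec F v = ∑ i ∈ F, w i := by
      rw [finVec, ← Finset.sum_coe_sort F w]
      refine Finset.sum_congr rfl fun i _ => ?_
      by_cases h : (i : I) ∈ t <;> simp [v, w, h]
    rw [e1, e2]
    exact Finset.sum_subset hsF fun i _ hi => by simp [w, hi]
  rw [hv, inner_finVec, norm_finVec_sq]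
  refine hg F k v fun i hi => ?_
  by_cases h : (i : I) ∈ t
  · exfalso
    apply hi
    have h2 := hF i h
    rw [dif_pos i.2] at h2
    rw [← h2]
    exact ht h
  · simp [v, h]

/-- Polarization gives `4 Re⟨Tx, y⟩` as a difference of the form at `x + y` and `x - y`; for unit
vectors the parallelogram law bounds it by `4C`. -/
lemma norm_le_of_abs_re_inner_le {E : Type*} [NormedAddCommGroup E] [InnerProductSpace ℂ E]
    [CompleteSpace E] {T : E →L[ℂ] E} (hT : IsSelfAdjoint T) {C : ℝ} (hC : 0 ≤ C)
    (h : ∀ x, |(inner ℂ x (T x)).re| ≤ C * ‖x‖ ^ 2) : ‖T‖ ≤ C := by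
  refine ContinuousLinearMap.opNorm_le_of_re_inner_le hC fun x y hx hy => ?_
  have hsym := ContinuousLinearMap.isSelfAdjoint_iff_isSymmetric.mp hT
  have h1 := (abs_le.mp (h (x + y))).2
  have h2 := (abs_le.mp (h (x - y))).1
  have h3 : inner ℂ x (T y) = inner ℂ (T x) y := (hsym x y).symm
  have h4 : (inner ℂ y (T x)).re = (inner ℂ (T x) y).re := by
    rw [← inner_conj_symm, Complex.conj_re]
  have h5 := parallelogram_law_with_norm ℂ x y
  rw [hx, hy] at h5
  simp only [map_add, map_sub, inner_add_left, inner_add_right, inner_sub_left, inner_sub_right,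
    Complex.add_re, Complex.sub_re, h3, h4] at h1 h2
  change (inner ℂ (T x) y).re ≤ C
  nlinarith

lemma isSelfAdjoint_coordProj (A : Set I) : IsSelfAdjoint (coordProj A) :=
  isSelfAdjoint_starProjection _

/-- The form bound passes from the algebraic span to its closure by continuity, and the form of the
compression at `x` is that of `T` at the projection of `x`. -/
lemma norm_compress_le {T : ell2 I →L[ℂ] ell2 I} (hT : IsSelfAdjoint T) {A : Set I} {C : ℝ}
    (hC : 0 ≤ C)
    (h : ∀ x ∈ Submodule.span ℂ (basisVec '' A), |(inner ℂ x (T x)).re| ≤ C * ‖x‖ ^ 2) :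
    ‖coordProj A * T * coordProj A‖ ≤ C := by
  have hcl : ∀ x ∈ coordSubspace A, |(inner ℂ x (T x)).re| ≤ C * ‖x‖ ^ 2 := by
    intro x hx
    have hclosed : IsClosed {x : ell2 I | |(inner ℂ x (T x)).re| ≤ C * ‖x‖ ^ 2} := by
      refine isClosed_le ?_ (by fun_prop)
      exact (Complex.continuous_re.comp (continuous_id.inner T.continuous)).abs
    exact closure_minimal h hclosed hx
  have hsa := isSelfAdjoint_coordProj A
  have hsym := ContinuousLinearMap.isSelfAdjoint_iff_isSymmetric.mp hsa
  refine norm_le_of_abs_re_inner_le ?_ hC fun x => ?_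
  · have := hT.conjugate (coordProj A)
    rwa [hsa.star_eq] at this
  · have h1 : inner ℂ x ((coordProj A * T * coordProj A) x) =
        inner ℂ (coordProj A x) (T (coordProj A x)) := (hsym x _).symm
    rw [h1]
    refine (hcl _ (Submodule.starProjection_apply_mem _ x)).trans ?_
    refine mul_le_mul_of_nonneg_left (pow_le_pow_left₀ (norm_nonneg _) ?_ 2) hC
    have := (coordProj A).le_of_opNorm_le (Submodule.starProjection_norm_le _) x
    rwa [one_mul] at this

lemma norm_compress_le_of_subset (T : ell2 I →L[ℂ] ell2 I) {A B : Set I} (h : A ⊆ B) :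
    ‖coordProj A * T * coordProj A‖ ≤ ‖coordProj B * T * coordProj B‖ := by
  have hle : coordSubspace A ≤ coordSubspace B :=
    Submodule.topologicalClosure_mono (Submodule.span_mono (Set.image_mono h))
  have h1 : coordProj A * coordProj B = coordProj A :=
    Submodule.starProjection_comp_starProjection_of_le hle
  have h2 : coordProj B * coordProj A = coordProj A := by
    have := congrArg star h1
    rwa [star_mul, (isSelfAdjoint_coordProj A).star_eq, (isSelfAdjoint_coordProj B).star_eq]
      at this
  have h3 : coordProj A * T * coordProj A =
      coordProj A * (coordProj B * T * coordProj B) * coordProj A := by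
    calc coordProj A * T * coordProj A
        = (coordProj A * coordProj B) * T * (coordProj B * coordProj A) := by rw [h1, h2]
      _ = _ := by simp only [mul_assoc]
  have hA : ‖coordProj A‖ ≤ 1 := Submodule.starProjection_norm_le _
  rw [h3]
  calc _ ≤ ‖coordProj A‖ * ‖coordProj B * T * coordProj B‖ * ‖coordProj A‖ := norm_mul₃_le
    _ ≤ 1 * ‖coordProj B * T * coordProj B‖ * 1 := by gcongr
    _ = _ := by ring

lemma norm_compress_le_norm (T : ell2 I →L[ℂ] ell2 I) (A : Set I) :
    ‖coordProj A * T * coordProj A‖ ≤ ‖T‖ := by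
  have hA : ‖coordProj A‖ ≤ 1 := Submodule.starProjection_norm_le _
  calc _ ≤ ‖coordProj A‖ * ‖T‖ * ‖coordProj A‖ := norm_mul₃_le
    _ ≤ 1 * ‖T‖ * 1 := by gcongr
    _ = _ := by ring

lemma hasPaving_of_coloring {T : ell2 I →L[ℂ] ell2 I} {r : ℕ} {ε : ℝ} (χ : I → Fin r)
    (h : ∀ k, ‖coordProj {i | χ i = k} * T * coordProj {i | χ i = k}‖ ≤ ε * ‖T‖) :
    HasPaving T r ε := by
  refine ⟨fun k => {i | χ i = k}, fun j k hjk => ?_, ?_, h⟩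
  · rw [Set.disjoint_left]
    intro i hj hk
    exact hjk (hj.symm.trans hk)
  · exact Set.eq_univ_of_forall fun i => Set.mem_iUnion.mpr ⟨χ i, rfl⟩

lemma HasPaving.exists_coloring {T : ell2 I →L[ℂ] ell2 I} {r : ℕ} {ε : ℝ} (h : HasPaving T r ε) :
    ∃ χ : I → Fin r, ∀ k, ‖coordProj {i | χ i = k} * T * coordProj {i | χ i = k}‖ ≤ ε * ‖T‖ := by
  obtain ⟨A, -, hcov, hA⟩ := h
  choose χ hχ using fun i => Set.mem_iUnion.mp (hcov ▸ Set.mem_univ i : i ∈ ⋃ j, A j)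
  refine ⟨χ, fun k => (norm_compress_le_of_subset T ?_).trans (hA k)⟩
  rintro i rfl
  exact hχ i

/-- The common refinement of two colorings. -/
def refineColoring {r s : ℕ} (χ₁ : I → Fin r) (χ₂ : I → Fin s) : I → Fin (r * s) :=
  fun i => finProdFinEquiv (χ₁ i, χ₂ i)

lemma refineColoring_subset {r s : ℕ} (χ₁ : I → Fin r) (χ₂ : I → Fin s) (k : Fin (r * s)) :
    ∃ k₁ k₂, {i | refineColoring χ₁ χ₂ i = k} ⊆ {i | χ₁ i = k₁} ∧
      {i | refineColoring χ₁ χ₂ i = k} ⊆ {i | χ₂ i = k₂} := by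
  refine ⟨(finProdFinEquiv.symm k).1, (finProdFinEquiv.symm k).2, ?_, ?_⟩ <;>
  · rintro i rfl
    simp [refineColoring]

/-- For either sign `(1 ± S/‖S‖)/2` is a positive contraction with diagonal `1/2`, and the bound
`(1+ε')/2` for it on a color class says `±S ≤ ε'‖S‖` there. The common refinement of the two
colorings gives both bounds, hence `r * r` classes. The minimum with `1/2` ensures `ε' < 1`. -/
theorem hasPaving_of_isSelfAdjoint {ε : ℝ} (hε : 0 < ε) {r : ℕ}
    (hr : 36 / (min ε (1 / 2)) ^ 2 ≤ r) {S : ell2 I →L[ℂ] ell2 I} (hS : IsSelfAdjoint S)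
    (hd : ∀ i, diagEntry S i = 0) : HasPaving S (r * r) ε := by
  have hε' : 0 < min ε (1 / 2) := lt_min hε (by norm_num)
  set ε' := min ε (1 / 2) with hε'def
  have hε'1 : ε' < 1 := (min_le_right _ _).trans_lt (by norm_num)
  have hr0 : 0 < r := by
    have : (0 : ℝ) < r := lt_of_lt_of_le (by positivity) hr
    exact_mod_cast this
  rcases eq_or_ne S 0 with rfl | hS0
  · exact hasPaving_of_coloring (fun _ => ⟨0, Nat.mul_pos hr0 hr0⟩) (by simp)
  have hn : 0 < ‖S‖ := norm_pos_iff.mpr hS0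
  have hbound : ∀ x, |(inner ℂ x (S x)).re| ≤ ‖S‖ * ‖x‖ ^ 2 := fun x => by
    calc |(inner ℂ x (S x)).re| ≤ ‖inner ℂ x (S x)‖ := Complex.abs_re_le_norm _
      _ ≤ ‖x‖ * ‖S x‖ := norm_inner_le_norm _ _
      _ ≤ ‖x‖ * (‖S‖ * ‖x‖) := by gcongr; exact S.le_opNorm x
      _ = _ := by ring
  have key : ∀ σ : ℝ, |σ| = 1 → ∃ χ : I → Fin r, ∀ k,
      ∀ x ∈ Submodule.span ℂ (basisVec '' {i | χ i = k}),
        σ * (inner ℂ x (S x)).re ≤ ε' * ‖S‖ * ‖x‖ ^ 2 := by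
    intro σ hσ
    let T : ell2 I →L[ℂ] ell2 I :=
      ((1 / 2 : ℝ) : ℂ) • (1 + ((σ / ‖S‖ : ℝ) : ℂ) • S)
    have hTx : ∀ x, (inner ℂ x (T x)).re =
        1 / 2 * (‖x‖ ^ 2 + σ / ‖S‖ * (inner ℂ x (S x)).re) := by
      intro x
      have hxx : (inner ℂ x x).re = ‖x‖ ^ 2 := by
        have := inner_self_eq_norm_sq (𝕜 := ℂ) x
        exact this
      simp only [T, smul_apply, add_apply,
        one_apply_eq_self, inner_smul_right, inner_add_right,
        Complex.re_ofReal_mul, Complex.add_re, hxx]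
    have hreal : ∀ a : ℝ, IsSelfAdjoint (a : ℂ) := Complex.conj_ofReal
    have hT : IsSelfAdjoint T :=
      (hreal (1 / 2)).smul ((IsSelfAdjoint.one _).add ((hreal (σ / ‖S‖)).smul hS))
    have hab : ∀ x, |σ / ‖S‖ * (inner ℂ x (S x)).re| ≤ ‖x‖ ^ 2 := by
      intro x
      rw [abs_mul, abs_div, hσ, abs_norm, one_div, inv_mul_eq_div, div_le_iff₀ hn, mul_comm]
      exact hbound x
    have hTd : ∀ i, diagEntry T i = 1 / 2 := by
      intro i
      have h1 : inner ℂ (basisVec i) (S (basisVec i)) = 0 := hd i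
      have h2 : inner ℂ (basisVec i : ell2 I) (basisVec i) = 1 := by
        rw [inner_self_eq_norm_sq_to_K, orthonormal_basisVec.1 i]; simp
      simp only [diagEntry, T, smul_apply, add_apply,
        one_apply_eq_self, inner_smul_right_eq_smul, inner_add_right, h1, h2]
      simp
    obtain ⟨χ, hχ⟩ := Paving.exists_coloring hT
      (fun x => by rw [hTx]; linarith [(abs_le.mp (hab x)).1])
      (fun x => by rw [hTx]; linarith [(abs_le.mp (hab x)).2]) hTd hε' hε'1 hr
    refine ⟨χ, fun k x hx => ?_⟩
    have h1 := hχ k x hx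
    rw [hTx] at h1
    have h2 : σ / ‖S‖ * (inner ℂ x (S x)).re ≤ ε' * ‖x‖ ^ 2 := by linarith
    rw [div_mul_eq_mul_div, div_le_iff₀ hn] at h2
    linarith
  obtain ⟨χ₁, h₁⟩ := key 1 (by simp)
  obtain ⟨χ₂, h₂⟩ := key (-1) (by simp)
  refine hasPaving_of_coloring (refineColoring χ₁ χ₂) fun k => ?_
  obtain ⟨k₁, k₂, hk₁, hk₂⟩ := refineColoring_subset χ₁ χ₂ k
  refine (norm_compress_le hS (C := ε' * ‖S‖) (by positivity) fun x hx => ?_).trans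
    (mul_le_mul_of_nonneg_right (min_le_left _ _) hn.le)
  have h3 := h₁ k₁ x (Submodule.span_mono (Set.image_mono hk₁) hx)
  have h4 := h₂ k₂ x (Submodule.span_mono (Set.image_mono hk₂) hx)
  rw [abs_le]
  constructor <;> linarith

/-- The real and imaginary parts of `T` also have zero diagonal and norm at most `‖T‖`. Paving each
with `ε/2` and refining suffices, since compression to a smaller set does not increase the norm. -/
theorem hasPaving_of_diag_eq_zero {ε : ℝ} {r : ℕ}
    (h : ∀ S : ell2 I →L[ℂ] ell2 I, IsSelfAdjoint S → (∀ i, diagEntry S i = 0) →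
      HasPaving S r (ε / 2)) (hε : 0 < ε) {T : ell2 I →L[ℂ] ell2 I}
    (hd : ∀ i, diagEntry T i = 0) : HasPaving T (r * r) ε := by
  have hd' : ∀ i, inner ℂ (basisVec i) (star T (basisVec i)) = 0 := by
    intro i
    rw [ContinuousLinearMap.star_eq_adjoint, ContinuousLinearMap.adjoint_inner_right,
      ← inner_conj_symm]
    have : inner ℂ (basisVec i) (T (basisVec i)) = 0 := hd i
    rw [this, map_zero]
  have hd0 : ∀ i, inner ℂ (basisVec i) (T (basisVec i)) = 0 := hd
  set S₁ : ell2 I →L[ℂ] ell2 I := (realPart T).1 with hS₁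
  set S₂ : ell2 I →L[ℂ] ell2 I := (imaginaryPart T).1 with hS₂
  have hT : T = S₁ + Complex.I • S₂ := (realPart_add_I_smul_imaginaryPart T).symm
  have hn₁ : ‖S₁‖ ≤ ‖T‖ := realPart.norm_le T
  have hn₂ : ‖S₂‖ ≤ ‖T‖ := imaginaryPart.norm_le T
  obtain ⟨χ₁, h₁⟩ := (h S₁ (realPart T).2 fun i => by
    rw [diagEntry, hS₁, realPart_apply_coe, ← Complex.coe_smul]
    simp only [smul_apply, add_apply,
      inner_smul_right_eq_smul, inner_add_right, hd0, hd', add_zero, smul_zero]).exists_coloring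
  obtain ⟨χ₂, h₂⟩ := (h S₂ (imaginaryPart T).2 fun i => by
    rw [diagEntry, hS₂, imaginaryPart_apply_coe, ← Complex.coe_smul]
    simp only [smul_apply, sub_apply,
      inner_smul_right_eq_smul, inner_sub_right, hd0, hd', sub_zero, smul_zero]).exists_coloring
  refine hasPaving_of_coloring (refineColoring χ₁ χ₂) fun k => ?_
  obtain ⟨k₁, k₂, hk₁, hk₂⟩ := refineColoring_subset χ₁ χ₂ k
  set P := coordProj {i | refineColoring χ₁ χ₂ i = k} with hP
  have h3 := (norm_compress_le_of_subset S₁ hk₁).trans (h₁ k₁)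
  have h4 := (norm_compress_le_of_subset S₂ hk₂).trans (h₂ k₂)
  have h5 : P * T * P = P * S₁ * P + Complex.I • (P * S₂ * P) := by
    conv_lhs => rw [hT]
    rw [mul_add, add_mul, mul_smul_comm, smul_mul_assoc]
  rw [h5]
  calc _ ≤ ‖P * S₁ * P‖ + ‖Complex.I • (P * S₂ * P)‖ := norm_add_le _ _
    _ = ‖P * S₁ * P‖ + ‖P * S₂ * P‖ := by rw [norm_smul, Complex.norm_I, one_mul]
    _ ≤ ε / 2 * ‖T‖ + ε / 2 * ‖T‖ :=
        add_le_add (h3.trans (by gcongr)) (h4.trans (by gcongr))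
    _ = ε * ‖T‖ := by ring

/-- A nonzero projection has norm `1` and is itself a positive contraction, so the one-sided form
bound is already a norm bound and no refinement is needed. For `ε ≥ 1` a single class works. -/
theorem hasPaving_of_projection {ε : ℝ} (hε : 0 < ε) {r : ℕ} (hr : 36 / ε ^ 2 ≤ r)
    {P : ell2 I →L[ℂ] ell2 I} (hP : IsSelfAdjoint P) (hPP : P * P = P)
    (hd : ∀ i, diagEntry P i = 1 / 2) : HasPaving P r ((1 + ε) / 2) := by
  have hr0 : 0 < r := by
    have : (0 : ℝ) < r := lt_of_lt_of_le (by positivity) hr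
    exact_mod_cast this
  rcases eq_or_ne P 0 with rfl | hP0
  · exact hasPaving_of_coloring (fun _ => ⟨0, hr0⟩) (by simp)
  rcases le_or_gt 1 ε with hε1 | hε1
  · refine hasPaving_of_coloring (fun _ => ⟨0, hr0⟩) fun k => ?_
    refine (norm_compress_le_norm P _).trans ?_
    nlinarith [norm_nonneg P]
  have hn1 : ‖P‖ ≤ 1 := IsStarProjection.norm_le P ⟨hPP, hP⟩
  have hn : 1 ≤ ‖P‖ := by
    have h1 : ‖P‖ ≤ ‖P‖ * ‖P‖ := by
      conv_lhs => rw [← hPP]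
      exact norm_mul_le _ _
    exact le_of_mul_le_mul_left (by linarith) (norm_pos_iff.mpr hP0)
  have hsym := ContinuousLinearMap.isSelfAdjoint_iff_isSymmetric.mp hP
  have hq : ∀ x, (inner ℂ x (P x)).re = ‖P x‖ ^ 2 := by
    intro x
    have h1 : inner ℂ x (P x) = inner ℂ (P x) (P x) := by
      have h2 : P x = P (P x) := by
        conv_lhs => rw [← hPP]
        rfl
      conv_lhs => rw [h2]
      exact (hsym x (P x)).symm
    rw [h1]
    exact inner_self_eq_norm_sq (𝕜 := ℂ) (P x)
  obtain ⟨χ, hχ⟩ := exists_coloring hP (fun x => by rw [hq]; positivity) (fun x => by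
    rw [hq]
    refine pow_le_pow_left₀ (norm_nonneg _) ?_ 2
    have := P.le_of_opNorm_le hn1 x
    rwa [one_mul] at this) hd hε hε1 hr
  refine hasPaving_of_coloring χ fun k => ?_
  refine (norm_compress_le hP (C := (1 + ε) / 2) (by positivity) fun x hx => ?_).trans ?_
  · rw [abs_of_nonneg (by rw [hq]; positivity)]
    exact hχ k x hx
  · nlinarith

end Operators

end Paving

/-! ### Assembly of the four paving statements. -/

theorem mainTheorem6 :
    -- (PB): bounded operators with zero diagonal
    (∀ ε : ℝ, 0 < ε → ∃ r : ℕ, ∀ (I : Type u) [Countable I]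
      (T : Paving.ell2 I →L[ℂ] Paving.ell2 I),
      (∀ i, Paving.diagEntry T i = 0) → Paving.HasPaving T r ε) ∧
    -- (PS): self-adjoint operators with zero diagonal
    (∀ ε : ℝ, 0 < ε → ∃ r : ℕ, ∀ (I : Type u) [Countable I]
      (S : Paving.ell2 I →L[ℂ] Paving.ell2 I),
      IsSelfAdjoint S → (∀ i, Paving.diagEntry S i = 0) → Paving.HasPaving S r ε) ∧
    -- (PR): reflections with zero diagonal
    (∀ ε : ℝ, 0 < ε → ∃ r : ℕ, ∀ (I : Type u) [Countable I]
      (R : Paving.ell2 I →L[ℂ] Paving.ell2 I),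
      IsSelfAdjoint R → R * R = 1 → (∀ i, Paving.diagEntry R i = 0) →
        Paving.HasPaving R r ε) ∧
    -- (PP_{1/2}): projections with diagonal 1/2, for every integer r ≥ 36 / ε ^ 2
    (∀ ε : ℝ, 0 < ε → ∀ r : ℕ, 36 / ε ^ 2 ≤ (r : ℝ) → ∀ (I : Type u) [Countable I]
      (P : Paving.ell2 I →L[ℂ] Paving.ell2 I),
      IsSelfAdjoint P → P * P = P → (∀ i, Paving.diagEntry P i = 1 / 2) →
        Paving.HasPaving P r ((1 + ε) / 2)) := by
  have hPS : ∀ ε : ℝ, 0 < ε → ∃ r : ℕ, ∀ (I : Type u)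
      (S : Paving.ell2 I →L[ℂ] Paving.ell2 I),
      IsSelfAdjoint S → (∀ i, Paving.diagEntry S i = 0) → Paving.HasPaving S r ε := fun ε hε =>
    ⟨_, fun _ _ hS hd => Paving.hasPaving_of_isSelfAdjoint hε (Nat.le_ceil _) hS hd⟩
  refine ⟨fun ε hε => ?_, fun ε hε => ?_, fun ε hε => ?_, fun ε hε r hr I _ P hP hPP hd =>
    Paving.hasPaving_of_projection hε hr hP hPP hd⟩
  · obtain ⟨r, hr⟩ := hPS (ε / 2) (by positivity)
    exact ⟨r * r, fun I _ T hd => Paving.hasPaving_of_diag_eq_zero (hr I) hε hd⟩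
  · obtain ⟨r, hr⟩ := hPS ε hε
    exact ⟨r, fun I _ S => hr I S⟩
  · obtain ⟨r, hr⟩ := hPS ε hε
    exact ⟨r, fun I _ R hR _ => hr I R hR⟩
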